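/- Let $\mathbf{HA}$ be Heyting arithmetic: first-order intuitionistic logic with equality (connectives $\land,\lor,\to,\bot,\forall,\exists$; $\neg\varphi :\equiv \varphi\to\bot$) in the language with a function symbol for every primitive recursive function, with the successor axioms $Sx \neq 0$ and $Sx = Sy \to x = y$, the defining equations of the primitive recursive functions, and induction for all formulas. Here $y<x$ denotes a quantifier-free formula expressing the order (such as $Sy \dot{-} x = 0$), $\exists y<x\,\theta :\equiv \exists y\,(y<x\land\theta)$ and $\forall y<x\,\theta :\equiv \forall y\,(y<x\to\theta)$. Let $\Sigma_0=\Pi_0$ be the set of quantifier-free formulas, $\Sigma_{j+1}=\{\exists x_1\cdots\exists x_n\,\varphi \mid n\ge 1,\ \varphi\in\Pi_j\}$ and $\Pi_{j+1}=\{\forall x_1\cdots\forall x_n\,\varphi \mid n\ge 1,\ \varphi\in\Sigma_j\}$; put $\Gamma\lor\Theta=\{\varphi\lor\psi \mid \varphi\in\Gamma,\ \psi\in\Theta\}$. The dual $\varphi^\bot$ of a prenex formula is given by $\varphi^\bot:\equiv\neg\varphi$ for quantifier-free $\varphi$, $(\forall x\,\varphi)^\bot:\equiv\exists x\,\varphi^\bot$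 and $(\exists x\,\varphi)^\bot:\equiv\forall x\,\varphi^\bot$. Formulas may contain parameters (free variables). Consider the following principles (schemes), for sets of formulas $\Gamma,\Theta$: - $\mathrm{DNE}_{\Gamma}$: $\ \neg\neg\varphi\to\varphi$, for $\varphi\in\Gamma$; - $\mathrm{DML}_{\Gamma}$: $\ \neg(\varphi\land\psi)\to\neg\varphi\lor\neg\psi$, for $\varphi,\psi\in\Gamma$; - $\mathrm{DML}_{\Gamma}^{\bot}$ (for sets $\Gamma$ of prenex formulas): $\ \neg(\varphi\land\psi)\to\varphi^\bot\lor\psi^\bot$, for $\varphi,\psi\in\Gamma$; - $\mathrm{CD}(\Gamma,\Theta)$: $\ \forall x\,(\varphi\lor\psi(x))\to\varphi\lor\forall x\,\psi(x)$, for $\varphi\in\Gamma$, $\psi(x)\in\Theta$ with $x$ not free in $\varphi$; - $\mathrm{COLL}_{\Gamma}$: $\ \forall w\,\exists y<x\,\forall z<w\,\varphi(y,z)\to\exists y<x\,\forall z\,\varphi(y,z)$, for $\varphi(y,z)\in\Gamma$ with $w$ not free in $\varphi$, where $w,x,y,z$ are distinct variables. For a theory $T$ and a principle $P$, let $T+P$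 be $T$ together with the universal closures of all instances of $P$; $P+Q$ is the principle whose instances are those of $P$ and those of $Q$. Two principles $P,Q$ are equivalent over $\mathbf{HA}$ if $\mathbf{HA}+P$ proves every instance of $Q$ and $\mathbf{HA}+Q$ proves every instance of $P$. **Theorem.** For every natural number $k\ge 1$, the following five principles are pairwise equivalent over $\mathbf{HA}$: 1. $\mathrm{DML}_{\Sigma_k}+\mathrm{DNE}_{\Sigma_{k-1}}$; 2. $\mathrm{DML}_{\Sigma_k}^{\bot}$; 3. $\mathrm{CD}(\Pi_k,\Pi_k)$; 4. $\mathrm{COLL}_{\Pi_k}$; 5. $\mathrm{DNE}_{\Pi_k\lor\Pi_k}$. -/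

import Mathlib

namespace HeytingArith

/-! ### Language -/

/-- Symbols for (definitions of) primitive recursive functions, by arity. In `prec f g` the
recursion is on the first argument:
`h(0, x) = f(x)` and `h(y + 1, x) = g(y, h(y, x), x)`. -/
inductive PR : ℕ → Type
  | zero : PR 0
  | succ : PR 1
  | proj {n : ℕ} (i : Fin n) : PR n
  | comp {m n : ℕ} (f : PR m) (g : Fin m → PR n) : PR n
  | prec {n : ℕ} (f : PR n) (g : PR (n + 2)) : PR (n + 1)

/-- The language of arithmetic: a function symbol for each primitive recursive definition, and
no relation symbol besides equality (which is part of the logic). -/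
def arithLang : FirstOrder.Language.{0, 0} := ⟨PR, fun _ => Empty⟩

/-- Terms whose variables are among `0, …, n - 1`. -/
abbrev Tm (n : ℕ) : Type := arithLang.Term (Fin n)

namespace Tm

/-- Variables as terms. -/
abbrev var {n : ℕ} (i : Fin n) : Tm n := FirstOrder.Language.Term.var i

/-- Application of a primitive recursive function symbol. -/
def app {m n : ℕ} (f : PR m) (ts : Fin m → Tm n) : Tm n :=
  FirstOrder.Language.Term.func (L := arithLang) f ts

/-- The constant `0`. -/
def zero {n : ℕ} : Tm n := app PR.zero ![]

/-- The successor of a term. -/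
def succ {n : ℕ} (t : Tm n) : Tm n := app PR.succ ![t]

/-- Weakening: all variables are moved up by one, so that the variable `0` becomes fresh. -/
def shift {n : ℕ} (t : Tm n) : Tm (n + 1) := t.relabel Fin.succ

/-- Lift of a substitution under a quantifier. -/
def up {n m : ℕ} (σ : Fin n → Tm m) : Fin (n + 1) → Tm (m + 1) :=
  Fin.cases (var 0) fun i => (σ i).shift

end Tm

/-- Formulas of intuitionistic first-order arithmetic with free variables among
`0, …, n - 1`, in de Bruijn style: a quantifier binds the variable `0` of its body, and the
variable `i + 1` of the body is the variable `i` outside. All of `⊥, ∧, ∨, →, ∀, ∃` are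
primitive, as they have to be in intuitionistic logic. -/
inductive Fml : ℕ → Type
  | falsum {n : ℕ} : Fml n
  | eq {n : ℕ} (t s : Tm n) : Fml n
  | and {n : ℕ} (φ ψ : Fml n) : Fml n
  | or {n : ℕ} (φ ψ : Fml n) : Fml n
  | imp {n : ℕ} (φ ψ : Fml n) : Fml n
  | all {n : ℕ} (φ : Fml (n + 1)) : Fml n
  | ex {n : ℕ} (φ : Fml (n + 1)) : Fml n

namespace Fml

/-- Negation, `φ → ⊥`. -/
def neg {n : ℕ} (φ : Fml n) : Fml n := φ.imp falsum

/-- Simultaneous capture-avoiding substitution. -/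
def subst : {n m : ℕ} → Fml n → (Fin n → Tm m) → Fml m
  | _, _, falsum, _ => falsum
  | _, _, eq t s, σ => eq (FirstOrder.Language.Term.subst t σ) (FirstOrder.Language.Term.subst s σ)
  | _, _, and φ ψ, σ => and (φ.subst σ) (ψ.subst σ)
  | _, _, or φ ψ, σ => or (φ.subst σ) (ψ.subst σ)
  | _, _, imp φ ψ, σ => imp (φ.subst σ) (ψ.subst σ)
  | _, _, all φ, σ => all (φ.subst (Tm.up σ))
  | _, _, ex φ, σ => ex (φ.subst (Tm.up σ))

/-- Weakening: `φ` regarded as a formula with one further variable `0`, not occurring in it. -/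
def shift {n : ℕ} (φ : Fml n) : Fml (n + 1) := φ.subst fun i => Tm.var i.succ

/-- `φ(t)`: the variable `0` is replaced by `t`. -/
def inst {n : ℕ} (φ : Fml (n + 1)) (t : Tm n) : Fml n := φ.subst (Fin.cases t Tm.var)

/-- A sentence regarded as a formula with `n` further variables. -/
def ofSentence {n : ℕ} (φ : Fml 0) : Fml n := φ.subst Fin.elim0

/-- Universal closure. -/
def univClosure : {n : ℕ} → Fml n → Fml 0
  | 0, φ => φ
  | _ + 1, φ => univClosure (all φ)

/-- Quantifier-free formulas. -/
def IsQF : {n : ℕ} → Fml n → Prop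
  | _, falsum => True
  | _, eq _ _ => True
  | _, and φ ψ => φ.IsQF ∧ ψ.IsQF
  | _, or φ ψ => φ.IsQF ∧ ψ.IsQF
  | _, imp φ ψ => φ.IsQF ∧ ψ.IsQF
  | _, all _ => False
  | _, ex _ => False

/-- The dual of a formula in prenex normal form: it swaps the quantifiers of the prefix and negates
the quantifier-free matrix. (On formulas that are not prenex the value has no meaning.) -/
def dual : {n : ℕ} → Fml n → Fml n
  | _, all φ => ex φ.dual
  | _, ex φ => all φ.dual
  | _, φ => φ.neg

end Fml

/-! ### Intuitionistic provability -/

/-- A theory is a set of sentences. -/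
abbrev Theory : Type := Set (Fml 0)

/-- Natural deduction for intuitionistic first-order logic with equality: `Prf T Γ φ` says that
`φ` is derivable from the axioms of `T` and the open assumptions `Γ`. -/
inductive Prf (T : Theory) : {n : ℕ} → List (Fml n) → Fml n → Prop
  | ax {n : ℕ} {Γ : List (Fml n)} {φ : Fml 0} : φ ∈ T → Prf T Γ φ.ofSentence
  | hyp {n : ℕ} {Γ : List (Fml n)} {φ : Fml n} : φ ∈ Γ → Prf T Γ φ
  | falsumE {n : ℕ} {Γ : List (Fml n)} {φ : Fml n} : Prf T Γ Fml.falsum → Prf T Γ φ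
  | andI {n : ℕ} {Γ : List (Fml n)} {φ ψ : Fml n} :
      Prf T Γ φ → Prf T Γ ψ → Prf T Γ (φ.and ψ)
  | andE₁ {n : ℕ} {Γ : List (Fml n)} {φ ψ : Fml n} : Prf T Γ (φ.and ψ) → Prf T Γ φ
  | andE₂ {n : ℕ} {Γ : List (Fml n)} {φ ψ : Fml n} : Prf T Γ (φ.and ψ) → Prf T Γ ψ
  | orI₁ {n : ℕ} {Γ : List (Fml n)} {φ ψ : Fml n} : Prf T Γ φ → Prf T Γ (φ.or ψ)
  | orI₂ {n : ℕ} {Γ : List (Fml n)} {φ ψ : Fml n} : Prf T Γ ψ → Prf T Γ (φ.or ψ)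
  | orE {n : ℕ} {Γ : List (Fml n)} {φ ψ χ : Fml n} :
      Prf T Γ (φ.or ψ) → Prf T (φ :: Γ) χ → Prf T (ψ :: Γ) χ → Prf T Γ χ
  | impI {n : ℕ} {Γ : List (Fml n)} {φ ψ : Fml n} : Prf T (φ :: Γ) ψ → Prf T Γ (φ.imp ψ)
  | impE {n : ℕ} {Γ : List (Fml n)} {φ ψ : Fml n} :
      Prf T Γ (φ.imp ψ) → Prf T Γ φ → Prf T Γ ψ
  | allI {n : ℕ} {Γ : List (Fml n)} {φ : Fml (n + 1)} :
      Prf T (Γ.map Fml.shift) φ → Prf T Γ φ.all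
  | allE {n : ℕ} {Γ : List (Fml n)} {φ : Fml (n + 1)} (t : Tm n) :
      Prf T Γ φ.all → Prf T Γ (φ.inst t)
  | exI {n : ℕ} {Γ : List (Fml n)} {φ : Fml (n + 1)} (t : Tm n) :
      Prf T Γ (φ.inst t) → Prf T Γ φ.ex
  | exE {n : ℕ} {Γ : List (Fml n)} {φ : Fml (n + 1)} {χ : Fml n} :
      Prf T Γ φ.ex → Prf T (φ :: Γ.map Fml.shift) χ.shift → Prf T Γ χ
  | eqRefl {n : ℕ} {Γ : List (Fml n)} (t : Tm n) : Prf T Γ (Fml.eq t t)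
  | eqSubst {n : ℕ} {Γ : List (Fml n)} (φ : Fml (n + 1)) {t s : Tm n} :
      Prf T Γ (Fml.eq t s) → Prf T Γ (φ.inst t) → Prf T Γ (φ.inst s)

/-- `T ⊢ φ` for a sentence `φ`. -/
def Theory.Proves (T : Theory) (φ : Fml 0) : Prop := Prf T [] φ

/-! ### Classes of formulas, principles, Heyting arithmetic -/

/-- A set of formulas, given as the sets of its members with free variables among `0, …, n - 1`.
A principle is given by the set of its instances. -/
abbrev FmlClass : Type := ∀ n : ℕ, Set (Fml n)

/-- `T + P`: the universal closures of all instances of `P` are added to `T` as axioms. -/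
def Theory.add (T : Theory) (P : FmlClass) : Theory :=
  T ∪ {χ | ∃ n : ℕ, ∃ φ ∈ P n, χ = φ.univClosure}

/-- `T` proves (the universal closure of) every instance of `P`. -/
def Theory.ProvesAll (T : Theory) (P : FmlClass) : Prop :=
  ∀ n : ℕ, ∀ φ ∈ P n, T.Proves φ.univClosure

/-- `P` and `Q` are equivalent over `T`. -/
def EquivOver (T : Theory) (P Q : FmlClass) : Prop :=
  (T.add P).ProvesAll Q ∧ (T.add Q).ProvesAll P

/-- The sum `P + Q` of two principles: all instances of `P` and all instances of `Q`. -/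
def FmlClass.add (P Q : FmlClass) : FmlClass := fun n => P n ∪ Q n

/-- The non-logical axioms of Heyting arithmetic: the axioms for the successor, the defining
equations of the primitive recursive functions, and induction for all formulas. -/
inductive HAAxiom : (n : ℕ) → Fml n → Prop
  | succ_ne_zero : HAAxiom 1 (Fml.eq (Tm.var 0).succ Tm.zero).neg
  | succ_inj : HAAxiom 2
      ((Fml.eq (Tm.var 0).succ (Tm.var 1).succ).imp (Fml.eq (Tm.var 0) (Tm.var 1)))
  | proj {n : ℕ} (i : Fin n) : HAAxiom n (Fml.eq (Tm.app (PR.proj i) Tm.var) (Tm.var i))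
  | comp {m n : ℕ} (f : PR m) (g : Fin m → PR n) : HAAxiom n
      (Fml.eq (Tm.app (PR.comp f g) Tm.var) (Tm.app f fun j => Tm.app (g j) Tm.var))
  | prec_zero {n : ℕ} (f : PR n) (g : PR (n + 2)) : HAAxiom n
      (Fml.eq (Tm.app (PR.prec f g) (Matrix.vecCons Tm.zero Tm.var)) (Tm.app f Tm.var))
  | prec_succ {n : ℕ} (f : PR n) (g : PR (n + 2)) : HAAxiom (n + 1)
      (Fml.eq
        (Tm.app (PR.prec f g) (Matrix.vecCons (Tm.var 0).succ fun i => Tm.var i.succ))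
        (Tm.app g (Matrix.vecCons (Tm.var 0)
          (Matrix.vecCons (Tm.app (PR.prec f g) Tm.var) fun i => Tm.var i.succ))))
  | induction {n : ℕ} (φ : Fml (n + 1)) : HAAxiom n
      (((φ.inst Tm.zero).and
        (φ.imp (φ.subst (Fin.cases (Tm.var 0).succ fun i => Tm.var i.succ))).all).imp φ.all)

/-- Heyting arithmetic. -/
def HA : Theory := Theory.add ∅ fun n => {φ | HAAxiom n φ}

/-- Formulas `∃ x₁ ⋯ ∃ xₘ φ` with `m ≥ 1` and `φ` in `C`. -/
inductive ExBlock (C : FmlClass) : (n : ℕ) → Fml n → Prop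
  | one {n : ℕ} {φ : Fml (n + 1)} : φ ∈ C (n + 1) → ExBlock C n φ.ex
  | more {n : ℕ} {φ : Fml (n + 1)} : ExBlock C (n + 1) φ → ExBlock C n φ.ex

/-- Formulas `∀ x₁ ⋯ ∀ xₘ φ` with `m ≥ 1` and `φ` in `C`. -/
inductive AllBlock (C : FmlClass) : (n : ℕ) → Fml n → Prop
  | one {n : ℕ} {φ : Fml (n + 1)} : φ ∈ C (n + 1) → AllBlock C n φ.all
  | more {n : ℕ} {φ : Fml (n + 1)} : AllBlock C (n + 1) φ → AllBlock C n φ.all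

mutual

/-- The class `Σ_k`. -/
def SigmaClass : ℕ → FmlClass
  | 0 => fun _ => {φ | φ.IsQF}
  | k + 1 => fun n => {φ | ExBlock (PiClass k) n φ}

/-- The class `Π_k`. -/
def PiClass : ℕ → FmlClass
  | 0 => fun _ => {φ | φ.IsQF}
  | k + 1 => fun n => {φ | AllBlock (SigmaClass k) n φ}

end

/-- `Γ ∨ Θ = {φ ∨ ψ | φ ∈ Γ, ψ ∈ Θ}`. -/
def FmlClass.or (C D : FmlClass) : FmlClass := fun n =>
  {χ | ∃ φ ∈ C n, ∃ ψ ∈ D n, χ = φ.or ψ}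

/-! ### The order relation and bounded quantifiers -/

/-- The predecessor function. -/
def PR.pred : PR 1 := PR.prec PR.zero (PR.proj 0)

/-- The function `(y, x) ↦ x ∸ y` (truncated subtraction). -/
def PR.monus : PR 2 := PR.prec (PR.proj 0) (PR.comp PR.pred ![PR.proj 1])

/-- `t < s`, as the quantifier-free formula `(t + 1) ∸ s = 0`. -/
def Fml.lt {n : ℕ} (t s : Tm n) : Fml n := Fml.eq (Tm.app PR.monus ![s, t.succ]) Tm.zero

/-- `∃ y < t, φ(y)`, that is `∃ y (y < t ∧ φ(y))`. -/
def Fml.exLt {n : ℕ} (t : Tm n) (φ : Fml (n + 1)) : Fml n :=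
  ((Fml.lt (Tm.var 0) t.shift).and φ).ex

/-- `∀ y < t, φ(y)`, that is `∀ y (y < t → φ(y))`. -/
def Fml.allLt {n : ℕ} (t : Tm n) (φ : Fml (n + 1)) : Fml n :=
  ((Fml.lt (Tm.var 0) t.shift).imp φ).all

/-! ### The principles -/

/-- Double negation elimination: `¬¬φ → φ` for `φ ∈ Γ`. -/
def DNE (C : FmlClass) : FmlClass := fun n => {χ | ∃ φ ∈ C n, χ = φ.neg.neg.imp φ}

/-- De Morgan's law: `¬(φ ∧ ψ) → ¬φ ∨ ¬ψ` for `φ, ψ ∈ Γ`. -/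
def DML (C : FmlClass) : FmlClass := fun n =>
  {χ | ∃ φ ∈ C n, ∃ ψ ∈ C n, χ = (φ.and ψ).neg.imp (φ.neg.or ψ.neg)}

/-- De Morgan's law with respect to duals: `¬(φ ∧ ψ) → φ^⊥ ∨ ψ^⊥` for `φ, ψ ∈ Γ`. -/
def DMLDual (C : FmlClass) : FmlClass := fun n =>
  {χ | ∃ φ ∈ C n, ∃ ψ ∈ C n, χ = (φ.and ψ).neg.imp (φ.dual.or ψ.dual)}

/-- The constant domain axiom: `∀ x (φ ∨ ψ(x)) → φ ∨ ∀ x ψ(x)` for `φ ∈ Γ` and `ψ(x) ∈ Θ`, where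
`x` does not occur in `φ`. -/
def CD (C D : FmlClass) : FmlClass := fun n =>
  {χ | ∃ φ ∈ C n, ∃ ψ ∈ D (n + 1), χ = (φ.shift.or ψ).all.imp (φ.or ψ.all)}

/-- The contrapositive collection principle:
`∀ w ∃ y < x ∀ z < w φ(y, z) → ∃ y < x ∀ z φ(y, z)` for `φ(y, z) ∈ Γ`. In `φ` the variable `0` is
`z`, the variable `1` is `y`, and the others are parameters, among which is `x`; in the premise
`w` (the variable `2` of the innermost scope) does not occur in `φ`. -/
def COLL (C : FmlClass) : FmlClass := fun n =>
  {χ | ∃ x : Fin n, ∃ φ ∈ C (n + 2), χ =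
    (Fml.exLt (Tm.var x.succ) (Fml.allLt (Tm.var 1)
      (φ.subst (Tm.up (Tm.up fun i => Tm.var i.succ))))).all.imp
    (Fml.exLt (Tm.var x) φ.all)}

end HeytingArith

namespace HeytingArith

open FirstOrder.Language Matrix Filter
open scoped symmDiff

/-! ### Substitution -/

-- The argument is semantic. An extension of HA has a canonical Heyting-valued model: truth values
-- are formulas with parameters modulo provable equivalence, elements are terms modulo provable
-- equality, and a formula true under all assignments is provable (`prf_of_eval_eq_top`). Hence it
-- suffices that the five principles are valid in the same `HAModel`s (`provesAll_of_valid`), where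
-- intuitionistic derivations become inequalities in a Heyting algebra.
--
-- Let k = m + 1. For prenex φ, the formulas φ and φ^⊥ exclude each other and φ^⊥⊥ is equivalent to
-- φ, because quantifier-free formulas are decidable. Every principle is compared with DML^⊥. DNE
-- for Σ_m turns ¬φ into φ^⊥ for φ in Σ_{m+1}, so principle 1 gives DML^⊥. Applied to duals, DML^⊥
-- gives DNE for Π_k ∨ Π_k, and this gives CD, whose premise proves the double negation of its
-- conclusion. CD decides all formulas up to level m (`Valid.dec_of_cd`): if φ(x) ∨ φ^⊥(x) for all
-- x, then ∃x φ ∨ ∀x φ^⊥. With this decidability CD gives back DML^⊥ by induction on a quantifier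
-- prefix, and DML^⊥ gives principle 1.
--
-- COLL gives CD by coding a disjunction as ∃y<2. Conversely, DML^⊥ extends by induction to bounded
-- conjunctions (`Valid.compl_ball_le_bex_dual`), while ordinary collection, provable in HA
-- (`eval_ball_ex`), shows that the premise of COLL refutes ∀y<x ∃z φ^⊥. The induction needs Σ_{m+1}
-- to be closed under bounded ∀ up to equivalence (`Dec.sigma_ball_mem_cl`); this again uses
-- decidability up to level m, which makes Π_j closed under bounded ∃ by dualization.

theorem term_subst_subst {α β γ : Type} (t : arithLang.Term α) (σ : α → arithLang.Term β)
    (τ : β → arithLang.Term γ) : (t.subst σ).subst τ = t.subst fun i => (σ i).subst τ := by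
  induction t with
  | var => rfl
  | func f ts ih => simp only [Term.subst, ih]

theorem term_subst_var {α : Type} (t : arithLang.Term α) : t.subst Term.var = t := by
  induction t with
  | var => rfl
  | func f ts ih => simp only [Term.subst, ih]

theorem term_relabel_eq_subst {α β : Type} (t : arithLang.Term α) (f : α → β) :
    t.relabel f = t.subst fun i => Term.var (f i) := by
  induction t with
  | var => rfl
  | func g ts ih => simp only [Term.subst, Term.relabel, ih]

namespace Tm

theorem shift_eq_subst {n : ℕ} (t : Tm n) : t.shift = t.subst fun i => var i.succ :=
  term_relabel_eq_subst t _

theorem shift_subst {n m : ℕ} (t : Tm n) (σ : Fin (n + 1) → Tm m) :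
    t.shift.subst σ = t.subst fun i => σ i.succ := by
  rw [shift_eq_subst, term_subst_subst]; rfl

theorem up_var {n : ℕ} : up (var : Fin n → Tm n) = var := by
  funext i; refine Fin.cases rfl (fun i => ?_) i; rfl

theorem up_subst {n m l : ℕ} (σ : Fin n → Tm m) (τ : Fin m → Tm l) :
    (fun i => (up σ i).subst (up τ)) = up fun i => (σ i).subst τ := by
  funext i
  refine Fin.cases rfl (fun i => ?_) i
  change (σ i).shift.subst (up τ) = shift (Term.subst (σ i) τ)
  rw [shift_subst, shift_eq_subst, term_subst_subst]
  congr 1; funext j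
  exact shift_eq_subst _

end Tm

namespace Fml

theorem subst_var {n : ℕ} (φ : Fml n) : φ.subst Tm.var = φ := by
  induction φ with
  | falsum => rfl
  | eq t s => simp only [subst, term_subst_var]
  | and φ ψ h₁ h₂ => simp only [subst, h₁, h₂]
  | or φ ψ h₁ h₂ => simp only [subst, h₁, h₂]
  | imp φ ψ h₁ h₂ => simp only [subst, h₁, h₂]
  | all φ h => simp only [subst, Tm.up_var, h]
  | ex φ h => simp only [subst, Tm.up_var, h]

theorem subst_subst {n m l : ℕ} (φ : Fml n) (σ : Fin n → Tm m) (τ : Fin m → Tm l) :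
    (φ.subst σ).subst τ = φ.subst fun i => (σ i).subst τ := by
  induction φ generalizing m l with
  | falsum => rfl
  | eq t s => simp only [subst, term_subst_subst]
  | and φ ψ h₁ h₂ => simp only [subst, h₁, h₂]
  | or φ ψ h₁ h₂ => simp only [subst, h₁, h₂]
  | imp φ ψ h₁ h₂ => simp only [subst, h₁, h₂]
  | all φ h => simp only [subst, h, Tm.up_subst]
  | ex φ h => simp only [subst, h, Tm.up_subst]

theorem shift_subst {n m : ℕ} (φ : Fml n) (σ : Fin (n + 1) → Tm m) :
    φ.shift.subst σ = φ.subst fun i => σ i.succ := subst_subst φ _ _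

theorem subst_shift {n m : ℕ} (φ : Fml n) (σ : Fin n → Tm m) :
    (φ.subst σ).shift = φ.shift.subst (Tm.up σ) := by
  rw [shift_subst, shift, subst_subst]
  congr 1; funext i
  exact (Tm.shift_eq_subst _).symm

theorem subst_up_inst {n m : ℕ} (φ : Fml (n + 1)) (σ : Fin n → Tm m) (t : Tm m) :
    (φ.subst (Tm.up σ)).inst t = φ.subst (Fin.cases t σ) := by
  rw [inst, subst_subst]
  congr 1; funext i
  refine Fin.cases rfl (fun i => ?_) i
  simp only [Tm.up, Fin.cases_succ, Tm.shift_subst]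
  exact term_subst_var _

theorem inst_subst {n m : ℕ} (φ : Fml (n + 1)) (σ : Fin n → Tm m) (t : Tm n) :
    (φ.inst t).subst σ = (φ.subst (Tm.up σ)).inst (Term.subst t σ) := by
  rw [subst_up_inst, inst, subst_subst]
  congr 1; funext i
  refine Fin.cases rfl (fun i => ?_) i
  rfl

end Fml

/-! ### Structural properties of provability -/

theorem Prf.weaken {T : Theory} {n : ℕ} {Γ : List (Fml n)} {φ : Fml n} (h : Prf T Γ φ) :
    ∀ {Δ : List (Fml n)}, Γ ⊆ Δ → Prf T Δ φ := by
  induction h with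
  | ax h => exact fun _ => .ax h
  | hyp h => exact fun H => .hyp (H h)
  | falsumE _ ih => exact fun H => .falsumE (ih H)
  | andI _ _ ih₁ ih₂ => exact fun H => .andI (ih₁ H) (ih₂ H)
  | andE₁ _ ih => exact fun H => .andE₁ (ih H)
  | andE₂ _ ih => exact fun H => .andE₂ (ih H)
  | orI₁ _ ih => exact fun H => .orI₁ (ih H)
  | orI₂ _ ih => exact fun H => .orI₂ (ih H)
  | orE _ _ _ ih ih₁ ih₂ =>
    exact fun H => .orE (ih H) (ih₁ (List.cons_subset_cons _ H)) (ih₂ (List.cons_subset_cons _ H))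
  | impI _ ih => exact fun H => .impI (ih (List.cons_subset_cons _ H))
  | impE _ _ ih₁ ih₂ => exact fun H => .impE (ih₁ H) (ih₂ H)
  | allI _ ih => exact fun H => .allI (ih (List.map_subset _ H))
  | allE t _ ih => exact fun H => .allE t (ih H)
  | exI t _ ih => exact fun H => .exI t (ih H)
  | exE _ _ ih₁ ih₂ =>
    exact fun H => .exE (ih₁ H) (ih₂ (List.cons_subset_cons _ (List.map_subset _ H)))
  | eqRefl t => exact fun _ => .eqRefl t
  | eqSubst φ _ _ ih₁ ih₂ => exact fun H => .eqSubst φ (ih₁ H) (ih₂ H)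

theorem map_shift_subst {n m : ℕ} (Γ : List (Fml n)) (σ : Fin n → Tm m) :
    (Γ.map Fml.shift).map (fun χ => χ.subst (Tm.up σ)) =
      (Γ.map fun χ => χ.subst σ).map Fml.shift := by
  simp only [List.map_map]
  exact List.map_congr_left fun χ _ => (Fml.subst_shift χ σ).symm

theorem Prf.subst {T : Theory} {n : ℕ} {Γ : List (Fml n)} {φ : Fml n} (h : Prf T Γ φ) :
    ∀ {m : ℕ} (σ : Fin n → Tm m), Prf T (Γ.map fun χ => χ.subst σ) (φ.subst σ) := by
  induction h with
  | @ax n Γ φ h =>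
    intro m σ
    have : (φ.ofSentence (n := n)).subst σ = φ.ofSentence := by
      rw [Fml.ofSentence, Fml.subst_subst, Fml.ofSentence]
      congr 1; funext i; exact i.elim0
    rw [this]; exact .ax h
  | hyp h => exact fun σ => .hyp (List.mem_map_of_mem h)
  | falsumE _ ih => exact fun σ => .falsumE (ih σ)
  | andI _ _ ih₁ ih₂ => exact fun σ => .andI (ih₁ σ) (ih₂ σ)
  | andE₁ _ ih => exact fun σ => .andE₁ (ih σ)
  | andE₂ _ ih => exact fun σ => .andE₂ (ih σ)
  | orI₁ _ ih => exact fun σ => .orI₁ (ih σ)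
  | orI₂ _ ih => exact fun σ => .orI₂ (ih σ)
  | orE _ _ _ ih ih₁ ih₂ => exact fun σ => .orE (ih σ) (ih₁ σ) (ih₂ σ)
  | impI _ ih => exact fun σ => .impI (ih σ)
  | impE _ _ ih₁ ih₂ => exact fun σ => .impE (ih₁ σ) (ih₂ σ)
  | allI _ ih =>
    intro m σ
    refine .allI ?_
    rw [← map_shift_subst]
    exact ih (Tm.up σ)
  | allE t _ ih =>
    intro m σ
    rw [Fml.inst_subst]
    exact .allE _ (ih σ)
  | exI t _ ih =>
    intro m σ
    refine .exI (Term.subst t σ) ?_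
    rw [← Fml.inst_subst]
    exact ih σ
  | exE _ _ ih₁ ih₂ =>
    intro m σ
    refine .exE (ih₁ σ) ?_
    rw [← map_shift_subst, Fml.subst_shift]
    exact ih₂ (Tm.up σ)
  | eqRefl t => exact fun σ => .eqRefl _
  | @eqSubst n Γ φ t s _ _ ih₁ ih₂ =>
    intro m σ
    rw [Fml.inst_subst]
    refine .eqSubst _ (ih₁ σ) ?_
    rw [← Fml.inst_subst]
    exact ih₂ σ

theorem Prf.cut {T : Theory} {n : ℕ} {Γ : List (Fml n)} {φ ψ : Fml n}
    (h₁ : Prf T Γ φ) (h₂ : Prf T (φ :: Γ) ψ) : Prf T Γ ψ :=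
  .impE (.impI h₂) h₁

theorem Fml.ofSentence_zero (φ : Fml 0) : φ.ofSentence (n := 0) = φ := by
  rw [Fml.ofSentence]
  convert Fml.subst_var φ using 2

theorem Fml.shift_inst_var {n : ℕ} (φ : Fml (n + 1)) :
    (φ.subst (Tm.up fun i => Tm.var i.succ)).inst (Tm.var 0) = φ := by
  rw [Fml.subst_up_inst]
  convert Fml.subst_var φ using 2
  funext i
  refine Fin.cases rfl (fun i => rfl) i

theorem prf_univClosure_iff {T : Theory} : ∀ {n : ℕ} {φ : Fml n},
    Prf T [] φ.univClosure ↔ Prf T [] φ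
  | 0, _ => Iff.rfl
  | n + 1, φ => by
    rw [Fml.univClosure, prf_univClosure_iff]
    refine ⟨fun h => ?_, fun h => .allI h⟩
    -- Weaken by a fresh variable and instantiate the quantifier with that variable.
    have := Prf.allE (Tm.var 0) (h.subst fun i => Tm.var i.succ)
    rwa [Fml.shift_inst_var] at this

theorem prf_of_univClosure_mem {T : Theory} {n : ℕ} {φ : Fml n} (h : φ.univClosure ∈ T) :
    Prf T [] φ := by
  have := Prf.ax (Γ := []) (n := 0) h
  rw [Fml.ofSentence_zero] at this
  exact prf_univClosure_iff.1 this

theorem prf_add_right {T : Theory} {P : FmlClass} {n : ℕ} {φ : Fml n} (h : φ ∈ P n) :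
    Prf (T.add P) [] φ :=
  prf_of_univClosure_mem (Or.inr ⟨n, φ, h, rfl⟩)

theorem prf_HA_add {P : FmlClass} {n : ℕ} {φ : Fml n} (h : HAAxiom n φ) :
    Prf (HA.add P) [] φ :=
  prf_of_univClosure_mem (Or.inl (Or.inr ⟨n, φ, h, rfl⟩))

/-! ### Formulas with parameters -/

/-- Terms with parameters, the parameters being natural numbers. -/
abbrev PTm : Type := arithLang.Term ℕ

namespace PTm

/-- The term over the first `M` parameters, the others being replaced by `0`. -/
def trunc (M : ℕ) (t : PTm) : Tm M := t.subst fun j => if h : j < M then Tm.var ⟨j, h⟩ else Tm.zero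

end PTm

/-- Renaming of the variable `x` to a new variable `0`. -/
def abstr (x : ℕ) {M : ℕ} (j : Fin M) : Tm (M + 1) :=
  if (j : ℕ) = x then Tm.var 0 else Tm.var j.succ

/-- A parameter beyond all those of `t` does not occur in it, so renaming it amounts to weakening.
-/
theorem PTm.eventually_trunc_abstr (t : PTm) :
    ∀ᶠ x in atTop, ∀ M, x < M → (t.trunc M).subst (abstr x) = (t.trunc M).shift := by
  induction t with
  | var j =>
    filter_upwards [eventually_gt_atTop j] with x hx M hM
    have : j < M := hx.trans hM
    simp [trunc, Term.subst, this, abstr, hx.ne, Tm.shift_eq_subst]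
  | func f ts ih =>
    filter_upwards [eventually_all.2 ih] with x hx M hM
    change Term.func f _ = Term.func f _
    congr 1; funext i
    exact hx i M hM

/-- A formula with parameters: a formula for each number of available parameters, in which almost
no parameter occurs. -/
structure PFml where
  fml : ∀ M : ℕ, Fml M
  fresh : ∀ᶠ x in atTop, ∀ M, x < M → (fml M).subst (abstr x) = (fml M).shift

namespace PFml

/-- The value of a formula at terms with parameters. -/
def of {n : ℕ} (φ : Fml n) (ρ : Fin n → PTm) : PFml where
  fml M := φ.subst fun i => (ρ i).trunc M
  fresh := by
    filter_upwards [eventually_all.2 fun i => (ρ i).eventually_trunc_abstr] with x hx M hM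
    rw [Fml.subst_subst, Fml.shift, Fml.subst_subst]
    congr 1; funext i
    rw [hx i M hM]
    exact Tm.shift_eq_subst _

def falsum : PFml := ⟨fun _ => .falsum, .of_forall fun _ _ _ => rfl⟩

def and (A B : PFml) : PFml where
  fml M := (A.fml M).and (B.fml M)
  fresh := by
    filter_upwards [A.fresh, B.fresh] with x h₁ h₂ M hM
    exact congrArg₂ Fml.and (h₁ M hM) (h₂ M hM)

def or (A B : PFml) : PFml where
  fml M := (A.fml M).or (B.fml M)
  fresh := by
    filter_upwards [A.fresh, B.fresh] with x h₁ h₂ M hM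
    exact congrArg₂ Fml.or (h₁ M hM) (h₂ M hM)

def imp (A B : PFml) : PFml where
  fml M := (A.fml M).imp (B.fml M)
  fresh := by
    filter_upwards [A.fresh, B.fresh] with x h₁ h₂ M hM
    exact congrArg₂ Fml.imp (h₁ M hM) (h₂ M hM)

variable (T : Theory)

/-- Entailment between formulas with parameters. -/
def Entails (A B : PFml) : Prop := ∀ᶠ M in atTop, Prf T [A.fml M] (B.fml M)

variable {T} {A B C : PFml}

theorem Entails.refl (A : PFml) : Entails T A A := .of_forall fun _ => .hyp (by simp)

theorem Entails.trans (h₁ : Entails T A B) (h₂ : Entails T B C) : Entails T A C := by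
  filter_upwards [h₁, h₂] with M h₁ h₂
  exact h₁.cut (h₂.weaken (by simp))

theorem entails_and : Entails T A (B.and C) ↔ Entails T A B ∧ Entails T A C := by
  refine ⟨fun h => ⟨h.mono fun M h => .andE₁ h, h.mono fun M h => .andE₂ h⟩, fun h => ?_⟩
  filter_upwards [h.1, h.2] with M h₁ h₂ using .andI h₁ h₂

theorem or_entails : Entails T (A.or B) C ↔ Entails T A C ∧ Entails T B C := by
  refine ⟨fun h => ⟨?_, ?_⟩, fun h => ?_⟩
  · filter_upwards [h] with M h
    exact Prf.cut (.orI₁ (.hyp (List.mem_singleton.2 rfl)))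
      (h.weaken (List.cons_subset_cons _ (by simp)))
  · filter_upwards [h] with M h
    exact Prf.cut (.orI₂ (.hyp (List.mem_singleton.2 rfl)))
      (h.weaken (List.cons_subset_cons _ (by simp)))
  · filter_upwards [h.1, h.2] with M h₁ h₂
    exact .orE (.hyp (List.mem_singleton.2 rfl)) (h₁.weaken (by simp)) (h₂.weaken (by simp))

theorem entails_imp : Entails T A (B.imp C) ↔ Entails T (A.and B) C := by
  refine ⟨fun h => ?_, fun h => ?_⟩
  · filter_upwards [h] with M h
    have h₁ : Prf T [(A.and B).fml M] ((A.fml M).and (B.fml M)) := .hyp (by simp [and])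
    exact .impE (Prf.cut (.andE₁ h₁) (h.weaken (by simp))) (.andE₂ h₁)
  · filter_upwards [h] with M h
    refine .impI (Prf.cut (.andI (.hyp (.tail _ (.head _))) (.hyp (.head _))) (h.weaken ?_))
    exact List.cons_subset_cons _ (by simp)

theorem falsum_entails : Entails T falsum A :=
  .of_forall fun _ => .falsumE (.hyp (by simp [falsum]))

theorem subst_trunc_cons_abstr {n : ℕ} (φ : Fml (n + 1)) {ρ : Fin n → PTm} {x M : ℕ} (hM : x < M)
    (hρ : ∀ i, ((ρ i).trunc M).subst (abstr x) = ((ρ i).trunc M).shift) :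
    (φ.subst fun i => PTm.trunc M (Matrix.vecCons (Term.var x) ρ i)).subst (abstr x) =
      φ.subst (Tm.up fun i => (ρ i).trunc M) := by
  rw [Fml.subst_subst]
  congr 1; funext i
  refine Fin.cases ?_ (fun i => ?_) i
  · simp [PTm.trunc, Term.subst, hM, abstr, Tm.up]
  · simpa [Tm.up] using hρ i

theorem subst_up_trunc_inst {n : ℕ} (φ : Fml (n + 1)) (ρ : Fin n → PTm) (t : PTm) (M : ℕ) :
    (φ.subst (Tm.up fun i => (ρ i).trunc M)).inst (t.trunc M) =
      φ.subst fun i => PTm.trunc M (Matrix.vecCons t ρ i) := by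
  rw [Fml.subst_up_inst]
  congr 1; funext i
  refine Fin.cases rfl (fun i => rfl) i

/-- For the converse, a parameter `x` fresh for `A` and `ρ` is used as a generic element: renaming
it to the de Bruijn variable `0` gives the premise of ∀-introduction. -/
theorem entails_all {n : ℕ} {φ : Fml (n + 1)} {ρ : Fin n → PTm} :
    Entails T A (of φ.all ρ) ↔ ∀ t, Entails T A (of φ (Matrix.vecCons t ρ)) := by
  refine ⟨fun h t => ?_, fun h => ?_⟩
  · filter_upwards [h] with M h
    have := Prf.allE (t.trunc M) h
    rwa [subst_up_trunc_inst] at this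
  · obtain ⟨x, hA, hρ⟩ :=
      (A.fresh.and (eventually_all.2 fun i => (ρ i).eventually_trunc_abstr)).exists
    filter_upwards [h (Term.var x), eventually_gt_atTop x] with M h hM
    refine .allI ?_
    have := h.subst (abstr x)
    rw [of, subst_trunc_cons_abstr φ hM fun i => hρ i M hM] at this
    simpa [hA M hM] using this

theorem ex_entails {n : ℕ} {φ : Fml (n + 1)} {ρ : Fin n → PTm} :
    Entails T (of φ.ex ρ) A ↔ ∀ t, Entails T (of φ (Matrix.vecCons t ρ)) A := by
  refine ⟨fun h t => ?_, fun h => ?_⟩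
  · filter_upwards [h] with M h
    refine Prf.cut (.exI (t.trunc M) ?_) (h.weaken (List.cons_subset_cons _ (by simp)))
    rw [subst_up_trunc_inst]
    exact .hyp (by simp [of])
  · obtain ⟨x, hA, hρ⟩ :=
      (A.fresh.and (eventually_all.2 fun i => (ρ i).eventually_trunc_abstr)).exists
    filter_upwards [h (Term.var x), eventually_gt_atTop x] with M h hM
    refine .exE (.hyp (List.mem_singleton.2 rfl)) ?_
    have := h.subst (abstr x)
    rw [hA M hM, of, List.map_cons, subst_trunc_cons_abstr φ hM fun i => hρ i M hM] at this
    exact this.weaken (List.cons_subset_cons _ (by simp))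

variable (T) in
/-- Provable equality of terms with parameters. -/
def TmEq (t s : PTm) : Prop := ∀ᶠ M in atTop, Prf T [] (Fml.eq (t.trunc M) (s.trunc M))

end PFml

-- Provable equality is a congruence.

theorem Fml.eq_inst {n : ℕ} (t s : Tm (n + 1)) (u : Tm n) :
    (Fml.eq t s).inst u = Fml.eq (t.subst (Fin.cases u Tm.var)) (s.subst (Fin.cases u Tm.var)) :=
  rfl

theorem Tm.shift_subst_cases {n : ℕ} (t u : Tm n) :
    (Tm.shift t).subst (Fin.cases u Tm.var) = t := by
  rw [Tm.shift_subst]; exact term_subst_var t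

section Equality

variable {T : Theory} {n : ℕ} {Γ : List (Fml n)} {t s u : Tm n}

theorem Prf.eqSymm (h : Prf T Γ (.eq t s)) : Prf T Γ (.eq s t) := by
  have := Prf.eqSubst (.eq (Tm.var 0) t.shift) h
  simp only [Fml.eq_inst, Tm.shift_subst_cases] at this
  exact this (.eqRefl t)

theorem Prf.eqTrans (h : Prf T Γ (.eq t s)) (h' : Prf T Γ (.eq s u)) : Prf T Γ (.eq t u) := by
  have := Prf.eqSubst (.eq t.shift (Tm.var 0)) h'
  simp only [Fml.eq_inst, Tm.shift_subst_cases] at this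
  exact this h

/-- Arguments are replaced one at a time; after stage `k` the first `k` have been exchanged. -/
theorem Prf.eqFunc {m : ℕ} (f : PR m) : ∀ {ts ss : Fin m → Tm n},
    (∀ i, Prf T Γ (.eq (ts i) (ss i))) → Prf T Γ (.eq (Tm.app f ts) (Tm.app f ss)) := by
  intro ts ss h
  have key : ∀ k ≤ m,
      Prf T Γ (.eq (Tm.app f ts) (Tm.app f fun i => if (i : ℕ) < k then ss i else ts i)) := by
    intro k
    induction k with
    | zero => intro _; simpa using Prf.eqRefl _
    | succ k ih =>
      intro hk
      -- Variable `0` marks the slot `k`: slots before it are already replaced, slots after it are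
      -- still original.
      have := Prf.eqSubst (.eq (Tm.app f ts).shift (Tm.app f fun i =>
        if (i : ℕ) < k then (ss i).shift else if (i : ℕ) = k then Tm.var 0 else (ts i).shift))
        (h ⟨k, hk⟩)
      simp only [Fml.eq_inst, Tm.shift_subst_cases] at this
      have aux : ∀ w : Tm n, Term.subst (Tm.app f fun i =>
          if (i : ℕ) < k then (ss i).shift else if (i : ℕ) = k then Tm.var 0 else (ts i).shift)
          (Fin.cases w Tm.var) = Tm.app f fun i =>
          if (i : ℕ) < k then ss i else if (i : ℕ) = k then w else ts i := by
        intro w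
        simp only [Tm.app, Term.subst]
        congr 1; funext i
        split_ifs
        · exact Tm.shift_subst_cases _ _
        · rfl
        · exact Tm.shift_subst_cases _ _
      rw [aux, aux] at this
      convert this ?_ using 3
      · funext i
        by_cases h₁ : (i : ℕ) < k
        · simp [h₁, h₁.trans k.lt_succ_self]
        · by_cases h₂ : (i : ℕ) = k
          · have : i = ⟨k, hk⟩ := Fin.ext h₂
            simp [this]
          · simp [h₁, h₂, show ¬ (i : ℕ) < k + 1 by omega]
      · convert ih (by omega) using 3
        funext i
        by_cases h₂ : (i : ℕ) = k
        · have : i = ⟨k, hk⟩ := Fin.ext h₂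
          simp [this]
        · simp [h₂]
  simpa using key m le_rfl

end Equality

namespace PFml

variable (T : Theory)

@[reducible] def tmSetoid : Setoid PTm where
  r := TmEq T
  iseqv :=
    { refl := fun _ => .of_forall fun _ => .eqRefl _
      symm := fun h => h.mono fun _ h => h.eqSymm
      trans := fun h h' => by
        filter_upwards [h, h'] with M h h' using h.eqTrans h' }

variable {T}

theorem TmEq.subst {α : Type} (t : arithLang.Term α) {ρ ρ' : α → PTm}
    (h : ∀ i, TmEq T (ρ i) (ρ' i)) : TmEq T (t.subst ρ) (t.subst ρ') := by
  induction t with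
  | var i => exact h i
  | func f ts ih =>
    filter_upwards [eventually_all.2 ih] with M hM
    exact Prf.eqFunc f hM

theorem trunc_subst {α : Type} (t : arithLang.Term α) (ρ : α → PTm) (M : ℕ) :
    PTm.trunc M (t.subst ρ) = t.subst fun i => (ρ i).trunc M :=
  term_subst_subst _ _ _

/-- This makes truth values independent of the terms chosen to represent elements of the domain.
Symmetry of equality is what handles the premise of an implication. -/
theorem entails_of_tmEq {n : ℕ} (φ : Fml n) {ρ ρ' : Fin n → PTm} (h : ∀ i, TmEq T (ρ i) (ρ' i)) :
    Entails T (of φ ρ) (of φ ρ') := by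
  induction φ with
  | falsum => exact .refl _
  | eq t s =>
    filter_upwards [TmEq.subst t h, TmEq.subst s h] with M h₁ h₂
    rw [trunc_subst, trunc_subst] at h₁ h₂
    exact ((h₁.weaken (by simp)).eqSymm.eqTrans (.hyp (by simp [of, Fml.subst]))).eqTrans
      (h₂.weaken (by simp))
  | and φ ψ ih₁ ih₂ =>
    refine entails_and (B := of φ _) (C := of ψ _).2 ⟨.trans ?_ (ih₁ h), .trans ?_ (ih₂ h)⟩
    · exact (entails_and.1 (.refl ((of φ ρ).and (of ψ ρ)))).1
    · exact (entails_and.1 (.refl ((of φ ρ).and (of ψ ρ)))).2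
  | or φ ψ ih₁ ih₂ =>
    refine or_entails (A := of φ _) (B := of ψ _).2 ⟨.trans (ih₁ h) ?_, .trans (ih₂ h) ?_⟩
    · exact (or_entails.1 (.refl ((of φ ρ').or (of ψ ρ')))).1
    · exact (or_entails.1 (.refl ((of φ ρ').or (of ψ ρ')))).2
  | imp φ ψ ih₁ ih₂ =>
    refine entails_imp (B := of φ _) (C := of ψ _).2 (.trans ?_ (ih₂ h))
    have h₁ := entails_and.1 (.refl (T := T) (((of φ ρ).imp (of ψ ρ)).and (of φ ρ')))
    have h₂ := ih₁ fun i => (h i).mono fun _ h => h.eqSymm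
    exact .trans (entails_and.2 ⟨h₁.1, h₁.2.trans h₂⟩) (entails_imp.1 (.refl _))
  | all φ ih =>
    refine entails_all.2 fun t => .trans (entails_all.1 (.refl _) t) (ih fun i => ?_)
    refine Fin.cases ?_ (fun i => h i) i
    exact .of_forall fun _ => .eqRefl _
  | ex φ ih =>
    refine ex_entails.2 fun t => .trans (ih fun i => ?_) (ex_entails.1 (.refl _) t)
    refine Fin.cases ?_ (fun i => h i) i
    exact .of_forall fun _ => .eqRefl _

end PFml

/-! ### The canonical Heyting-valued model of a theory -/

/-- Equivalence of formulas with parameters. -/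
@[reducible] def PFml.setoid (T : Theory) : Setoid PFml where
  r A B := PFml.Entails T A B ∧ PFml.Entails T B A
  iseqv :=
    { refl := fun A => ⟨.refl A, .refl A⟩
      symm := fun h => ⟨h.2, h.1⟩
      trans := fun h h' => ⟨h.1.trans h'.1, h'.2.trans h.2⟩ }

/-- The Lindenbaum algebra of a theory. -/
def Lind (T : Theory) : Type := Quotient (PFml.setoid T)

namespace Lind

variable {T : Theory}

open PFml

def mk (A : PFml) : Lind T := Quotient.mk (PFml.setoid T) A

instance : LE (Lind T) where
  le := Quotient.lift₂ (Entails T) fun _ _ _ _ h h' =>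
    propext ⟨fun H => (h.2.trans H).trans h'.1, fun H => (h.1.trans H).trans h'.2⟩

theorem mk_le_mk {A B : PFml} : (mk A : Lind T) ≤ mk B ↔ Entails T A B := Iff.rfl

theorem and_mono {A A' B B' : PFml} (h : Entails T A A') (h' : Entails T B B') :
    Entails T (A.and B) (A'.and B') :=
  have := entails_and.1 (.refl (T := T) (A.and B))
  entails_and.2 ⟨this.1.trans h, this.2.trans h'⟩

theorem or_mono {A A' B B' : PFml} (h : Entails T A A') (h' : Entails T B B') :
    Entails T (A.or B) (A'.or B') :=
  have := or_entails.1 (.refl (T := T) (A'.or B'))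
  or_entails.2 ⟨h.trans this.1, h'.trans this.2⟩

theorem imp_mono {A A' B B' : PFml} (h : Entails T A' A) (h' : Entails T B B') :
    Entails T (A.imp B) (A'.imp B') :=
  entails_imp.2 ((and_mono (.refl _) h).trans ((entails_imp.1 (.refl _)).trans h'))

instance : HeytingAlgebra (Lind T) where
  le_refl := by rintro ⟨A⟩; exact Entails.refl A
  le_trans := by rintro ⟨A⟩ ⟨B⟩ ⟨C⟩; exact Entails.trans
  le_antisymm := by rintro ⟨A⟩ ⟨B⟩ h h'; exact Quotient.sound ⟨h, h'⟩
  inf := Quotient.map₂ PFml.and fun _ _ h _ _ h' => ⟨and_mono h.1 h'.1, and_mono h.2 h'.2⟩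
  inf_le_left := by rintro ⟨A⟩ ⟨B⟩; exact (entails_and.1 (.refl (T := T) (A.and B))).1
  inf_le_right := by rintro ⟨A⟩ ⟨B⟩; exact (entails_and.1 (.refl (T := T) (A.and B))).2
  le_inf := by rintro ⟨A⟩ ⟨B⟩ ⟨C⟩ h h'; exact entails_and.2 ⟨h, h'⟩
  sup := Quotient.map₂ PFml.or fun _ _ h _ _ h' => ⟨or_mono h.1 h'.1, or_mono h.2 h'.2⟩
  le_sup_left := by rintro ⟨A⟩ ⟨B⟩; exact (or_entails.1 (.refl (T := T) (A.or B))).1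
  le_sup_right := by rintro ⟨A⟩ ⟨B⟩; exact (or_entails.1 (.refl (T := T) (A.or B))).2
  sup_le := by rintro ⟨A⟩ ⟨B⟩ ⟨C⟩ h h'; exact or_entails.2 ⟨h, h'⟩
  himp := Quotient.map₂ PFml.imp fun _ _ h _ _ h' => ⟨imp_mono h.2 h'.1, imp_mono h.1 h'.2⟩
  le_himp_iff := by rintro ⟨A⟩ ⟨B⟩ ⟨C⟩; exact entails_imp
  bot := mk falsum
  bot_le := by rintro ⟨A⟩; exact falsum_entails
  top := mk (falsum.imp falsum)
  le_top := by
    rintro ⟨A⟩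
    exact entails_imp.2 (entails_and.1 (.refl (T := T) (A.and falsum))).2
  compl := Quotient.map (fun A => A.imp falsum) fun _ _ h =>
    ⟨imp_mono h.2 (.refl _), imp_mono h.1 (.refl _)⟩
  himp_bot := by rintro ⟨A⟩; rfl

theorem mk_eq_top_iff {A : PFml} : (mk A : Lind T) = ⊤ ↔ ∀ᶠ M in atTop, Prf T [] (A.fml M) := by
  rw [eq_top_iff]
  refine ⟨fun h => ?_, fun h => ?_⟩
  · have h : Entails T (falsum.imp falsum) A := h
    filter_upwards [h] with M h
    exact Prf.cut (.impI (.hyp (List.mem_singleton.2 rfl))) h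
  · exact mk_le_mk.2 (h.mono fun M h => h.weaken (by simp))

end Lind

/-- Terms with parameters modulo provable equality. -/
def Dom (T : Theory) : Type := Quotient (PFml.tmSetoid T)

namespace Dom

variable {T : Theory}

open PFml

def mk (t : PTm) : Dom T := Quotient.mk (tmSetoid T) t

noncomputable def out (d : Dom T) : PTm := Quotient.out d

theorem mk_out (d : Dom T) : mk d.out = d := Quotient.out_eq d

theorem mk_eq_mk {t s : PTm} : (mk t : Dom T) = mk s ↔ TmEq T t s :=
  ⟨fun h => Quotient.exact h, fun h => Quotient.sound h⟩

noncomputable instance : arithLang.Structure (Dom T) where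
  funMap f ds := mk (Term.func f fun i => (ds i).out)
  RelMap r _ := r.elim

theorem funMap_mk {n : ℕ} (f : arithLang.Functions n) (ts : Fin n → PTm) :
    FirstOrder.Language.Structure.funMap f (fun i => (mk (ts i) : Dom T)) = mk (Term.func f ts) :=
  mk_eq_mk.2 (TmEq.subst (Term.func f Term.var) fun _ => mk_eq_mk.1 (mk_out _))

theorem realize_mk {α : Type} (t : arithLang.Term α) (ρ : α → PTm) :
    t.realize (fun i => (mk (ρ i) : Dom T)) = mk (t.subst ρ) := by
  induction t with
  | var => rfl
  | func f ts ih =>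
    simp only [Term.realize, ih, funMap_mk, Term.subst]

/-- The value of a formula in the canonical model. -/
noncomputable def eval {n : ℕ} (φ : Fml n) (ρ : Fin n → Dom T) : Lind T :=
  Lind.mk (of φ fun i => (ρ i).out)

theorem eval_mk {n : ℕ} (φ : Fml n) (ρ : Fin n → PTm) :
    eval φ (fun i => (mk (ρ i) : Dom T)) = Lind.mk (of φ ρ) :=
  le_antisymm (entails_of_tmEq φ fun _ => mk_eq_mk.1 (mk_out _))
    (entails_of_tmEq φ fun _ => mk_eq_mk.1 (mk_out _).symm)

theorem exists_mk {n : ℕ} (ρ : Fin n → Dom T) : ∃ ρ' : Fin n → PTm, ρ = fun i => mk (ρ' i) :=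
  ⟨fun i => (ρ i).out, funext fun _ => (mk_out _).symm⟩

theorem eval_cons_mk {n : ℕ} (φ : Fml (n + 1)) (t : PTm) (ρ : Fin n → PTm) :
    eval φ (Matrix.vecCons (mk t : Dom T) fun i => mk (ρ i)) =
      Lind.mk (of φ (Matrix.vecCons t ρ)) := by
  rw [← eval_mk]
  congr 1; funext i
  refine Fin.cases rfl (fun i => rfl) i

theorem of_subst {n m : ℕ} (φ : Fml n) (σ : Fin n → Tm m) (ρ : Fin m → PTm) :
    of (φ.subst σ) ρ = of φ fun i => (σ i).subst ρ := by
  unfold PFml.of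
  congr 1
  funext M
  rw [Fml.subst_subst]
  congr 1; funext i
  exact (trunc_subst _ _ _).symm

end Dom

/-- A Heyting-valued model of Heyting arithmetic, with truth values in `L` and domain `D`. -/
structure HAModel (D L : Type) [HeytingAlgebra L] [arithLang.Structure D] where
  eval : {n : ℕ} → Fml n → (Fin n → D) → L
  /-- The value of an equation. -/
  E : D → D → L
  eval_falsum {n : ℕ} (ρ : Fin n → D) : eval .falsum ρ = ⊥
  eval_eq {n : ℕ} (t s : Tm n) (ρ : Fin n → D) : eval (.eq t s) ρ = E (t.realize ρ) (s.realize ρ)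
  eval_and {n : ℕ} (φ ψ : Fml n) (ρ : Fin n → D) : eval (φ.and ψ) ρ = eval φ ρ ⊓ eval ψ ρ
  eval_or {n : ℕ} (φ ψ : Fml n) (ρ : Fin n → D) : eval (φ.or ψ) ρ = eval φ ρ ⊔ eval ψ ρ
  eval_imp {n : ℕ} (φ ψ : Fml n) (ρ : Fin n → D) : eval (φ.imp ψ) ρ = eval φ ρ ⇨ eval ψ ρ
  le_eval_all {n : ℕ} {φ : Fml (n + 1)} {ρ : Fin n → D} {a : L} :
    a ≤ eval φ.all ρ ↔ ∀ x, a ≤ eval φ (Matrix.vecCons x ρ)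
  eval_ex_le {n : ℕ} {φ : Fml (n + 1)} {ρ : Fin n → D} {a : L} :
    eval φ.ex ρ ≤ a ↔ ∀ x, eval φ (Matrix.vecCons x ρ) ≤ a
  eval_subst {n m : ℕ} (φ : Fml n) (σ : Fin n → Tm m) (ρ : Fin m → D) :
    eval (φ.subst σ) ρ = eval φ fun i => (σ i).realize ρ
  E_eq_top {a b : D} : E a b = ⊤ ↔ a = b
  E_inf_eval_le {n : ℕ} (φ : Fml (n + 1)) (a b : D) (ρ : Fin n → D) :
    E a b ⊓ eval φ (Matrix.vecCons a ρ) ≤ eval φ (Matrix.vecCons b ρ)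
  eval_HA {n : ℕ} {φ : Fml n} : HAAxiom n φ → ∀ ρ, eval φ ρ = ⊤

-- Truth in the canonical model is provability.

theorem eval_eq_top_of_prf {T : Theory} {n : ℕ} {φ : Fml n} (h : Prf T [] φ) (ρ : Fin n → Dom T) :
    Dom.eval φ ρ = ⊤ :=
  Lind.mk_eq_top_iff.2 (.of_forall fun _ => h.subst _)

/-- The assignment sending each variable to the parameter of the same number is generic: truth there
is a derivation of `φ` itself, for a large supply of variables. -/
theorem prf_of_eval_eq_top {T : Theory} {n : ℕ} {φ : Fml n}
    (h : ∀ ρ : Fin n → Dom T, Dom.eval φ ρ = ⊤) : Prf T [] φ := by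
  have := h fun i => Dom.mk (Term.var i)
  rw [Dom.eval_mk, Lind.mk_eq_top_iff] at this
  obtain ⟨M, hM, hn⟩ := (this.and (eventually_ge_atTop n)).exists
  -- Return from `M` to `n` variables. The superfluous ones do not occur in the formula, so their
  -- value `Tm.zero` is arbitrary.
  have := hM.subst fun j : Fin M => if h : (j : ℕ) < n then Tm.var ⟨j, h⟩ else Tm.zero
  rw [PFml.of, Fml.subst_subst] at this
  refine cast (congrArg (Prf T []) ?_) this
  refine (congrArg φ.subst (funext fun i => ?_)).trans (Fml.subst_var φ)
  have : (i : ℕ) < M := i.2.trans_le hn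
  simp [PTm.trunc, Term.subst, this]

/-- The canonical model of an extension of Heyting arithmetic. -/
noncomputable def canonicalModel (T : Theory)
    (hT : ∀ {n : ℕ} {φ : Fml n}, HAAxiom n φ → Prf T [] φ) : HAModel (Dom T) (Lind T) where
  eval := Dom.eval
  E a b := Dom.eval (.eq (Tm.var 0) (Tm.var 1)) ![a, b]
  eval_falsum _ := rfl
  eval_eq {n} t s ρ := by
    obtain ⟨ρ, rfl⟩ := Dom.exists_mk ρ
    rw [Dom.realize_mk, Dom.realize_mk, Dom.eval_mk]
    have := Dom.eval_mk (T := T) (.eq (Tm.var 0) (Tm.var 1)) ![t.subst ρ, s.subst ρ]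
    convert this.symm using 1
    · rw [show Fml.eq t s = (Fml.eq (Tm.var 0) (Tm.var 1)).subst ![t, s] from rfl, Dom.of_subst]
      congr 2; funext i
      fin_cases i <;> rfl
    · congr 1; funext i
      fin_cases i <;> rfl
  eval_and _ _ _ := rfl
  eval_or _ _ _ := rfl
  eval_imp _ _ _ := rfl
  le_eval_all {n φ ρ a} := by
    obtain ⟨ρ, rfl⟩ := Dom.exists_mk ρ
    obtain ⟨A⟩ := a
    rw [Dom.eval_mk]
    refine (PFml.entails_all).trans ⟨?_, fun h t => ?_⟩
    · rintro h ⟨t⟩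
      exact (h t).trans (Dom.eval_cons_mk (T := T) φ t ρ).ge
    · exact (h (Dom.mk t)).trans (Dom.eval_cons_mk (T := T) φ t ρ).le
  eval_ex_le {n φ ρ a} := by
    obtain ⟨ρ, rfl⟩ := Dom.exists_mk ρ
    obtain ⟨A⟩ := a
    rw [Dom.eval_mk]
    refine (PFml.ex_entails).trans ⟨?_, fun h t => ?_⟩
    · rintro h ⟨t⟩
      exact (Dom.eval_cons_mk (T := T) φ t ρ).le.trans (h t)
    · exact (Dom.eval_cons_mk (T := T) φ t ρ).ge.trans (h (Dom.mk t))
  eval_subst φ σ ρ := by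
    obtain ⟨ρ, rfl⟩ := Dom.exists_mk ρ
    simp only [Dom.realize_mk, Dom.eval_mk, Dom.of_subst]
  E_eq_top {a b} := by
    obtain ⟨t, rfl⟩ : ∃ t, Dom.mk t = a := ⟨_, Dom.mk_out a⟩
    obtain ⟨s, rfl⟩ : ∃ t, Dom.mk t = b := ⟨_, Dom.mk_out b⟩
    rw [Dom.mk_eq_mk]
    have : ![(Dom.mk t : Dom T), Dom.mk s] = fun i => Dom.mk (![t, s] i) := by
      funext i; fin_cases i <;> rfl
    rw [this, Dom.eval_mk, Lind.mk_eq_top_iff]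
    rfl
  E_inf_eval_le {n} φ a b ρ := by
    obtain ⟨ρ, rfl⟩ := Dom.exists_mk ρ
    obtain ⟨t, rfl⟩ : ∃ t, Dom.mk t = a := ⟨_, Dom.mk_out a⟩
    obtain ⟨s, rfl⟩ : ∃ t, Dom.mk t = b := ⟨_, Dom.mk_out b⟩
    have : ![(Dom.mk t : Dom T), Dom.mk s] = fun i => Dom.mk (![t, s] i) := by
      funext i; fin_cases i <;> rfl
    rw [this, Dom.eval_mk, Dom.eval_cons_mk, Dom.eval_cons_mk]
    refine Lind.mk_le_mk.2 (.of_forall fun M => ?_)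
    change Prf T [Fml.and (.eq (t.trunc M) (s.trunc M)) _] _
    simp only [PFml.of, ← PFml.subst_up_trunc_inst]
    have h : Prf T [Fml.and (.eq (t.trunc M) (s.trunc M))
        ((φ.subst (Tm.up fun i => (ρ i).trunc M)).inst (t.trunc M))] _ :=
      .hyp (List.mem_singleton.2 rfl)
    exact .eqSubst _ (.andE₁ h) (.andE₂ h)
  eval_HA h ρ := eval_eq_top_of_prf (hT h) ρ

/-- A principle is valid in a model if all of its instances are. -/
def HAModel.Valid {D L : Type} [HeytingAlgebra L] [arithLang.Structure D] (M : HAModel D L)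
    (P : FmlClass) : Prop :=
  ∀ ⦃n : ℕ⦄ ⦃φ : Fml n⦄, φ ∈ P n → ∀ ρ, M.eval φ ρ = ⊤

/-- The canonical model of HA + `P` validates `P`, since its instances are axioms there; hence it
validates `Q`, and truth in it is provability. -/
theorem provesAll_of_valid {P Q : FmlClass}
    (h : ∀ {D L : Type} [HeytingAlgebra L] [arithLang.Structure D] (M : HAModel D L),
      M.Valid P → M.Valid Q) : (HA.add P).ProvesAll Q := fun _ _ hφ =>
  prf_univClosure_iff.2 <| prf_of_eval_eq_top <|
    h (canonicalModel (HA.add P) prf_HA_add)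
      (fun _ _ hψ => eval_eq_top_of_prf (prf_add_right hψ)) hφ

/-! ### Reasoning in a model -/

/-- Proof by cases under a standing assumption `X`, which is distributivity in the Heyting algebra.
-/
theorem le_of_le_sup {L : Type} [HeytingAlgebra L] {X a b c : L} (h : X ≤ a ⊔ b) (ha : X ⊓ a ≤ c)
    (hb : X ⊓ b ≤ c) : X ≤ c :=
  (le_inf le_rfl h).trans (by rw [inf_sup_left]; exact sup_le ha hb)

section Functions

variable {D : Type} [arithLang.Structure D]

/-- The interpretation of a function symbol. -/
def fn {n : ℕ} (f : PR n) (xs : Fin n → D) : D :=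
  FirstOrder.Language.Structure.funMap (L := arithLang) f xs

variable (D) in
/-- The interpretation of `0`. -/
def zer : D := fn PR.zero ![]

/-- The interpretation of the successor. -/
def suc (x : D) : D := fn PR.succ ![x]

theorem realize_app {m n : ℕ} (f : PR m) (ts : Fin m → Tm n) (ρ : Fin n → D) :
    (Tm.app f ts).realize ρ = fn f fun i => (ts i).realize ρ := rfl

@[simp] theorem realize_zero {n : ℕ} (ρ : Fin n → D) : (Tm.zero).realize ρ = zer D := by
  rw [Tm.zero, realize_app, zer]; congr 1; exact Subsingleton.elim _ _

@[simp] theorem realize_succ {n : ℕ} (t : Tm n) (ρ : Fin n → D) :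
    (Tm.succ t).realize ρ = suc (t.realize ρ) := by
  rw [Tm.succ, realize_app, suc]; congr 1; funext i; fin_cases i; rfl

@[simp] theorem realize_shift {n : ℕ} (t : Tm n) (x : D) (ρ : Fin n → D) :
    (Tm.shift t).realize (vecCons x ρ) = t.realize ρ :=
  Term.realize_relabel

end Functions

namespace HAModel

variable {D L : Type} [HeytingAlgebra L] [arithLang.Structure D] (M : HAModel D L)

attribute [simp] eval_falsum eval_eq eval_and eval_or eval_imp

@[simp] theorem eval_neg {n : ℕ} (φ : Fml n) (ρ : Fin n → D) : M.eval φ.neg ρ = (M.eval φ ρ)ᶜ := by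
  simp [Fml.neg]

@[simp] theorem eval_shift {n : ℕ} (φ : Fml n) (x : D) (ρ : Fin n → D) :
    M.eval φ.shift (vecCons x ρ) = M.eval φ ρ := by
  rw [Fml.shift, eval_subst]; rfl

@[simp] theorem eval_inst {n : ℕ} (φ : Fml (n + 1)) (t : Tm n) (ρ : Fin n → D) :
    M.eval (φ.inst t) ρ = M.eval φ (vecCons (t.realize ρ) ρ) := by
  rw [Fml.inst, eval_subst]; congr 1; funext i; refine Fin.cases rfl (fun _ => rfl) i

theorem eval_all_le {n : ℕ} (φ : Fml (n + 1)) (ρ : Fin n → D) (x : D) :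
    M.eval φ.all ρ ≤ M.eval φ (vecCons x ρ) := M.le_eval_all.1 le_rfl x

theorem le_eval_ex {n : ℕ} (φ : Fml (n + 1)) (ρ : Fin n → D) (x : D) :
    M.eval φ (vecCons x ρ) ≤ M.eval φ.ex ρ := M.eval_ex_le.1 le_rfl x

theorem inf_eval_ex_le {n : ℕ} {φ : Fml (n + 1)} {ρ : Fin n → D} {a b : L} :
    a ⊓ M.eval φ.ex ρ ≤ b ↔ ∀ x, a ⊓ M.eval φ (vecCons x ρ) ≤ b := by
  simp only [inf_comm a, ← le_himp_iff, M.eval_ex_le]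

theorem eval_all_congr {n m : ℕ} {φ : Fml (n + 1)} {ψ : Fml (m + 1)} {ρ : Fin n → D}
    {ρ' : Fin m → D} (h : ∀ x, M.eval φ (vecCons x ρ) = M.eval ψ (vecCons x ρ')) :
    M.eval φ.all ρ = M.eval ψ.all ρ' :=
  le_antisymm (M.le_eval_all.2 fun x => (M.eval_all_le _ _ x).trans (h x).le)
    (M.le_eval_all.2 fun x => (M.eval_all_le _ _ x).trans (h x).ge)

theorem eval_ex_congr {n m : ℕ} {φ : Fml (n + 1)} {ψ : Fml (m + 1)} {ρ : Fin n → D}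
    {ρ' : Fin m → D} (h : ∀ x, M.eval φ (vecCons x ρ) = M.eval ψ (vecCons x ρ')) :
    M.eval φ.ex ρ = M.eval ψ.ex ρ' :=
  le_antisymm (M.eval_ex_le.2 fun x => (h x).le.trans (M.le_eval_ex _ _ x))
    (M.eval_ex_le.2 fun x => (h x).ge.trans (M.le_eval_ex _ _ x))

/-! ### Equality and the defining equations -/

@[simp] theorem E_self (a : D) : M.E a a = ⊤ := M.E_eq_top.2 rfl

theorem E_congr {n : ℕ} (t : Tm (n + 1)) (a b : D) (ρ : Fin n → D) :
    M.E a b ≤ M.E (t.realize (vecCons a ρ)) (t.realize (vecCons b ρ)) := by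
  -- In the formula t(v₁) = t(v₀) only v₀ passes from `a` to `b`, while v₁ is held at `a`; so the
  -- premise is an instance of reflexivity.
  have := M.E_inf_eval_le
    (.eq (t.subst (Fin.cases (Tm.var 1) fun i => Tm.var i.succ.succ))
      (t.subst (Fin.cases (Tm.var 0) fun i => Tm.var i.succ.succ))) a b (vecCons a ρ)
  simp only [eval_eq, Term.realize_subst] at this
  have e₀ : ∀ c : D, (fun i => Term.realize (vecCons c (vecCons a ρ))
      (Fin.cases (motive := fun _ => Tm (n + 2)) (Tm.var 0) (fun i => Tm.var i.succ.succ) i)) =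
      vecCons c ρ := fun c => by
    funext i; refine Fin.cases rfl (fun _ => rfl) i
  have e₁ : ∀ c : D, (fun i => Term.realize (vecCons c (vecCons a ρ))
      (Fin.cases (motive := fun _ => Tm (n + 2)) (Tm.var 1) (fun i => Tm.var i.succ.succ) i)) =
      vecCons a ρ := fun c => by
    funext i; refine Fin.cases rfl (fun _ => rfl) i
  rw [e₀, e₀, e₁, e₁, E_self, inf_top_eq] at this
  exact this

theorem E_comm (a b : D) : M.E a b = M.E b a := by
  have h : ∀ a b, M.E a b ≤ M.E b a := fun a b => by
    have := M.E_inf_eval_le (.eq (Tm.var 0) (Tm.var 1)) a b ![a]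
    simpa [Term.realize] using this
  exact le_antisymm (h a b) (h b a)

theorem E_inf_eval_le' {n : ℕ} (φ : Fml (n + 1)) (a b : D) (ρ : Fin n → D) :
    M.E a b ⊓ M.eval φ (vecCons b ρ) ≤ M.eval φ (vecCons a ρ) := by
  rw [E_comm]; exact M.E_inf_eval_le φ b a ρ

@[simp] theorem E_suc_zer (x : D) : M.E (suc x) (zer D) = ⊥ := by
  have := M.eval_HA .succ_ne_zero ![x]
  rw [eval_neg, eval_eq] at this
  simpa [Term.realize] using le_compl_self.1 (le_top.trans this.ge)

theorem E_suc_suc_le (x y : D) : M.E (suc x) (suc y) ≤ M.E x y := by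
  simpa [Term.realize] using M.eval_HA .succ_inj ![x, y]

theorem E_le_suc (x y : D) : M.E x y ≤ M.E (suc x) (suc y) := by
  simpa [Term.realize] using M.E_congr (Tm.succ (Tm.var 0)) x y ![]

@[simp] theorem E_suc_suc (x y : D) : M.E (suc x) (suc y) = M.E x y :=
  le_antisymm (M.E_suc_suc_le x y) (M.E_le_suc x y)

include M

/-- By `E_eq_top` an equation of value `⊤` is an identity in `D`, so the defining equations become
rewrite rules. -/
theorem fn_proj {n : ℕ} (i : Fin n) (xs : Fin n → D) : fn (PR.proj i) xs = xs i := by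
  have := M.eval_HA (.proj i) xs
  rwa [eval_eq, M.E_eq_top] at this

theorem fn_comp {m n : ℕ} (f : PR m) (g : Fin m → PR n) (xs : Fin n → D) :
    fn (PR.comp f g) xs = fn f fun j => fn (g j) xs := by
  have := M.eval_HA (.comp f g) xs
  rwa [eval_eq, M.E_eq_top] at this

theorem fn_prec_zero {n : ℕ} (f : PR n) (g : PR (n + 2)) (xs : Fin n → D) :
    fn (PR.prec f g) (vecCons (zer D) xs) = fn f xs := by
  have := M.eval_HA (.prec_zero f g) xs
  rw [eval_eq, M.E_eq_top] at this
  refine Eq.trans ?_ this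
  rw [realize_app]
  congr 1; funext i
  refine Fin.cases (by simp) (fun _ => rfl) i

theorem fn_prec_suc {n : ℕ} (f : PR n) (g : PR (n + 2)) (x : D) (xs : Fin n → D) :
    fn (PR.prec f g) (vecCons (suc x) xs) =
      fn g (vecCons x (vecCons (fn (PR.prec f g) (vecCons x xs)) xs)) := by
  have := M.eval_HA (.prec_succ f g) (vecCons x xs)
  rw [eval_eq, M.E_eq_top] at this
  convert this using 1
  · rw [realize_app]
    congr 1; funext i
    refine Fin.cases (by simp [Term.realize]) (fun _ => rfl) i
  · rw [realize_app]
    congr 1; funext i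
    refine Fin.cases rfl (fun i => Fin.cases rfl (fun _ => rfl) i) i

/-! ### Induction -/

/-- Induction is available only for definable predicates, hence the formula `φ` behind `F`;
separating the two lets `F` be written with elements of `D`. The value `X` plays the part of side
assumptions. -/
theorem induction_on {n : ℕ} (φ : Fml (n + 1)) (ρ : Fin n → D) {X : L} {F : D → L}
    (hF : ∀ x, M.eval φ (vecCons x ρ) = F x) (h₀ : X ≤ F (zer D))
    (hs : ∀ x, X ⊓ F x ≤ F (suc x)) (x : D) : X ≤ F x := by
  have := M.eval_HA (.induction φ) ρ
  rw [eval_imp, himp_eq_top_iff, eval_and, eval_inst, realize_zero, hF] at this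
  rw [← hF]
  refine (le_inf h₀ ?_).trans (this.trans (M.eval_all_le _ _ x))
  rw [le_eval_all]
  intro y
  rw [eval_imp, le_himp_iff, hF, eval_subst]
  refine (hs y).trans ?_
  rw [← hF]
  refine le_of_eq (congrArg _ (funext fun i => ?_))
  refine Fin.cases (by simp [Term.realize]) (fun _ => rfl) i

theorem cases_on {n : ℕ} (φ : Fml (n + 1)) (ρ : Fin n → D) {X : L} {F : D → L}
    (hF : ∀ x, M.eval φ (vecCons x ρ) = F x) (h₀ : X ≤ F (zer D))
    (hs : ∀ x, X ≤ F (suc x)) (x : D) : X ≤ F x :=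
  M.induction_on φ ρ hF h₀ (fun x => inf_le_left.trans (hs x)) x

theorem eq_of_induction {n : ℕ} (φ ψ : Fml (n + 1)) (ρ : Fin n → D) {F G : D → L}
    (hF : ∀ x, M.eval φ (vecCons x ρ) = F x) (hG : ∀ x, M.eval ψ (vecCons x ρ) = G x)
    (h₀ : F (zer D) = G (zer D))
    (hs : ∀ x, F x ⇔ G x ≤ F (suc x) ⇔ G (suc x)) (x : D) : F x = G x := by
  have := M.induction_on ((ψ.imp φ).and (φ.imp ψ)) ρ (X := ⊤) (F := fun x => F x ⇔ G x)
    (fun x => by simp [hF, hG, bihimp_def]) (by simp [h₀]) (fun x => by simpa using hs x) x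
  simpa using this

theorem eq_of_cases {n : ℕ} (φ ψ : Fml (n + 1)) (ρ : Fin n → D) {F G : D → L}
    (hF : ∀ x, M.eval φ (vecCons x ρ) = F x) (hG : ∀ x, M.eval ψ (vecCons x ρ) = G x)
    (h₀ : F (zer D) = G (zer D)) (hs : ∀ x, F (suc x) = G (suc x)) (x : D) : F x = G x :=
  M.eq_of_induction φ ψ ρ hF hG h₀ (fun x => by simp [hs]) x

end HAModel

/-! ### Order -/

section Functions

variable {D : Type} [arithLang.Structure D]

/-- Truncated subtraction. -/
def monus (x y : D) : D := fn PR.monus ![y, x]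

theorem realize_monus {n : ℕ} (t s : Tm n) (ρ : Fin n → D) :
    (Tm.app PR.monus ![t, s]).realize ρ = monus (s.realize ρ) (t.realize ρ) := by
  rw [realize_app, monus]; congr 1; funext i; fin_cases i <;> rfl

end Functions

namespace HAModel

variable {D L : Type} [HeytingAlgebra L] [arithLang.Structure D] (M : HAModel D L)

/-- The value of `a < b`. -/
def lt (a b : D) : L := M.E (monus (suc a) b) (zer D)

@[simp] theorem eval_lt {n : ℕ} (t s : Tm n) (ρ : Fin n → D) :
    M.eval (.lt t s) ρ = M.lt (t.realize ρ) (s.realize ρ) := by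
  rw [Fml.lt, eval_eq, realize_monus, realize_succ, realize_zero, lt]

theorem le_eval_allLt {n : ℕ} {t : Tm n} {φ : Fml (n + 1)} {ρ : Fin n → D} {a : L} :
    a ≤ M.eval (.allLt t φ) ρ ↔
      ∀ x, a ⊓ M.lt x (t.realize ρ) ≤ M.eval φ (vecCons x ρ) := by
  simp [Fml.allLt, M.le_eval_all, Term.realize]

theorem inf_eval_exLt_le {n : ℕ} {t : Tm n} {φ : Fml (n + 1)} {ρ : Fin n → D} {a b : L} :
    a ⊓ M.eval (.exLt t φ) ρ ≤ b ↔
      ∀ x, a ⊓ M.lt x (t.realize ρ) ⊓ M.eval φ (vecCons x ρ) ≤ b := by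
  simp [Fml.exLt, M.inf_eval_ex_le, Term.realize, inf_assoc]

theorem eval_exLt_le {n : ℕ} {t : Tm n} {φ : Fml (n + 1)} {ρ : Fin n → D} {b : L} :
    M.eval (.exLt t φ) ρ ≤ b ↔
      ∀ x, M.lt x (t.realize ρ) ⊓ M.eval φ (vecCons x ρ) ≤ b := by
  simp [Fml.exLt, M.eval_ex_le, Term.realize]

theorem inf_le_eval_exLt {n : ℕ} (t : Tm n) (φ : Fml (n + 1)) (ρ : Fin n → D) (x : D) :
    M.lt x (t.realize ρ) ⊓ M.eval φ (vecCons x ρ) ≤ M.eval (.exLt t φ) ρ :=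
  M.eval_exLt_le.1 le_rfl x

theorem eval_allLt_inf_le {n : ℕ} (t : Tm n) (φ : Fml (n + 1)) (ρ : Fin n → D) (x : D) :
    M.eval (.allLt t φ) ρ ⊓ M.lt x (t.realize ρ) ≤ M.eval φ (vecCons x ρ) :=
  M.le_eval_allLt.1 le_rfl x

include M

theorem E_le_fn_one (f : PR 1) (a b : D) : M.E a b ≤ M.E (fn f ![a]) (fn f ![b]) := by
  have h (c : D) : Term.realize (vecCons c ![]) (Tm.app f ![Tm.var 0]) = fn f ![c] := by
    rw [realize_app]; congr 1; funext i; fin_cases i; rfl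
  simpa only [h] using M.E_congr (Tm.app f ![Tm.var 0]) a b ![]

theorem monus_zer (x : D) : monus x (zer D) = x := by
  rw [monus, PR.monus, M.fn_prec_zero, M.fn_proj]; rfl

theorem pred_zer : fn PR.pred ![zer D] = zer D := by
  rw [PR.pred, M.fn_prec_zero]; rfl

theorem pred_suc (x : D) : fn PR.pred ![suc x] = x := by
  rw [PR.pred, M.fn_prec_suc, M.fn_proj]; rfl

theorem monus_suc (x y : D) : monus x (suc y) = fn PR.pred ![monus x y] := by
  rw [monus, PR.monus, M.fn_prec_suc, M.fn_comp]
  congr 1; funext i; fin_cases i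
  simp [M.fn_proj, monus, PR.monus]

theorem zer_monus (y : D) : monus (zer D) y = zer D := by
  rw [← M.E_eq_top, eq_top_iff]
  refine M.induction_on (.eq (Tm.app PR.monus ![Tm.var 0, Tm.zero]) Tm.zero) ![]
    (F := fun y => M.E (monus (zer D) y) (zer D)) (fun y => ?_) ?_ (fun y => ?_) y
  · simp [realize_monus, Term.realize]
  · simp [M.monus_zer]
  · rw [M.monus_suc, top_inf_eq]
    refine (M.E_le_fn_one PR.pred _ _).trans ?_
    rw [M.pred_zer]

theorem suc_monus_suc (x y : D) : monus (suc x) (suc y) = monus x y := by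
  rw [← M.E_eq_top, eq_top_iff]
  refine M.induction_on (.eq (Tm.app PR.monus ![Tm.succ (Tm.var 0), Tm.succ (Tm.var 1)])
    (Tm.app PR.monus ![Tm.var 0, Tm.var 1])) ![x]
    (F := fun y => M.E (monus (suc x) (suc y)) (monus x y)) (fun y => ?_) ?_ (fun y => ?_) y
  · simp [realize_monus, Term.realize]
  · simp [M.monus_suc, M.monus_zer, M.pred_suc]
  · rw [M.monus_suc (suc x) (suc y), M.monus_suc x y, top_inf_eq]
    exact M.E_le_fn_one PR.pred _ _

theorem monus_self (x : D) : monus x x = zer D := by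
  rw [← M.E_eq_top, eq_top_iff]
  refine M.induction_on (.eq (Tm.app PR.monus ![Tm.var 0, Tm.var 0]) Tm.zero) ![]
    (F := fun x => M.E (monus x x) (zer D)) (fun y => ?_) ?_ (fun y => ?_) x
  · simp [realize_monus, Term.realize]
  · simp [M.monus_zer]
  · rw [M.suc_monus_suc]; exact inf_le_right

@[simp] theorem lt_zer (y : D) : M.lt y (zer D) = ⊥ := by
  rw [lt, M.monus_zer, E_suc_zer]

@[simp] theorem zer_lt_suc (y : D) : M.lt (zer D) (suc y) = ⊤ := by
  rw [lt, M.suc_monus_suc, M.zer_monus, E_self]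

@[simp] theorem suc_lt_suc (x y : D) : M.lt (suc x) (suc y) = M.lt x y := by
  rw [lt, M.suc_monus_suc, lt]

theorem lt_suc_eq_E (y x : D) : M.lt y (suc x) = M.E (monus y x) (zer D) := by
  rw [lt, M.suc_monus_suc]

/-- Induction on `x` with `y` quantified inside the induction formula, then a case distinction on
`y`; successors cancel on both sides. -/
theorem lt_suc_le (x y : D) : M.lt y (suc x) ≤ M.lt y x ⊔ M.E y x := by
  let ψ : Fml 2 := .imp (.lt (Tm.var 0) (Tm.succ (Tm.var 1)))
      (.or (.lt (Tm.var 0) (Tm.var 1)) (.eq (Tm.var 0) (Tm.var 1)))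
  have hψ (x y : D) : M.eval ψ ![y, x] = M.lt y (suc x) ⇨ M.lt y x ⊔ M.E y x := by
    simp [ψ, Term.realize]
  have := M.induction_on ψ.all ![] (X := ⊤) (fun _ => rfl) ?_ (fun x => ?_) x
  · simpa [hψ] using this.trans (M.eval_all_le _ _ y)
  · rw [M.le_eval_all]
    intro y
    rw [hψ, M.lt_suc_eq_E, M.monus_zer]; simp
  · rw [top_inf_eq, M.le_eval_all]
    intro y
    rw [hψ]
    refine M.cases_on (ψ.subst ![Tm.var 0, Tm.succ (Tm.var 1)]) ![x]
      (F := fun y => M.lt y (suc (suc x)) ⇨ M.lt y (suc x) ⊔ M.E y (suc x))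
      (fun y => ?_) ?_ (fun y => ?_) y
    · simp [eval_subst, ψ, Term.realize]
    · simp
    · have := M.eval_all_le ψ ![x] y
      rw [hψ] at this
      simpa using this

theorem lt_suc (y x : D) : M.lt y (suc x) = M.lt y x ⊔ M.E y x := by
  refine le_antisymm (M.lt_suc_le x y) (sup_le ?_ ?_)
  · rw [lt, lt_suc_eq_E, ← M.suc_monus_suc y x, M.monus_suc (suc y) x]
    refine (M.E_le_fn_one PR.pred _ _).trans ?_
    rw [M.pred_zer]
  · rw [lt_suc_eq_E]
    have := M.E_inf_eval_le' (.eq (Tm.app PR.monus ![Tm.var 1, Tm.var 0]) Tm.zero) y x ![x]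
    simpa [realize_monus, Term.realize, M.monus_self] using this

theorem lt_self_suc (x : D) : M.lt x (suc x) = ⊤ := by simp [lt_suc]

theorem le_lt_suc (y x : D) : M.lt y x ≤ M.lt y (suc x) := by simp [lt_suc]

/-- This reduces any equation to equations with right-hand side 0, as characteristic functions
require. The nontrivial inequality is the same double induction as in `lt_suc_le`. -/
theorem monus_antisymm (x y : D) :
    M.E (monus x y) (zer D) ⊓ M.E (monus y x) (zer D) = M.E x y := by
  refine le_antisymm ?_ ?_
  · let ψ : Fml 2 := .imp (.and (.eq (Tm.app PR.monus ![Tm.var 0, Tm.var 1]) Tm.zero)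
      (.eq (Tm.app PR.monus ![Tm.var 1, Tm.var 0]) Tm.zero)) (.eq (Tm.var 1) (Tm.var 0))
    have hψ (x y : D) : M.eval ψ ![y, x] =
        M.E (monus x y) (zer D) ⊓ M.E (monus y x) (zer D) ⇨ M.E x y := by
      simp [ψ, realize_monus, Term.realize]
    have := M.induction_on ψ.all ![] (X := ⊤) (fun _ => rfl) ?_ (fun x => ?_) x
    · simpa [hψ] using this.trans (M.eval_all_le _ _ y)
    · rw [M.le_eval_all]
      intro y
      rw [hψ, M.monus_zer, M.E_comm (zer D)]; simp
    · rw [top_inf_eq, M.le_eval_all]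
      intro y
      rw [hψ]
      refine M.cases_on (ψ.subst ![Tm.var 0, Tm.succ (Tm.var 1)]) ![x]
        (F := fun y => M.E (monus (suc x) y) (zer D) ⊓ M.E (monus y (suc x)) (zer D) ⇨
          M.E (suc x) y) (fun y => ?_) ?_ (fun y => ?_) y
      · simp [eval_subst, ψ, realize_monus, Term.realize]
      · simp [M.monus_zer]
      · have := M.eval_all_le ψ ![x] y
        rw [hψ] at this
        simpa [M.suc_monus_suc] using this
  · rw [← lt_suc_eq_E, ← lt_suc_eq_E, lt_suc, lt_suc, M.E_comm y x]
    exact le_inf le_sup_right le_sup_right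

/-- Any two elements have a strict common upper bound. -/
theorem exists_lt_lt (a b : D) : ∃ c, M.lt a c = ⊤ ∧ ∀ v, M.lt v b ≤ M.lt v c := by
  let add : PR 2 := .prec (.proj 0) (.comp .succ ![.proj 1])
  have add_zer (y : D) : fn add ![zer D, y] = y := by
    rw [M.fn_prec_zero, M.fn_proj]; rfl
  have add_suc (x y : D) : fn add ![suc x, y] = suc (fn add ![x, y]) := by
    rw [M.fn_prec_suc, M.fn_comp, suc]
    congr 1; funext i; fin_cases i
    simp [M.fn_proj, add]
  have realize_add {n : ℕ} (t s : Tm n) (ρ : Fin n → D) :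
      (Tm.app add ![t, s]).realize ρ = fn add ![t.realize ρ, s.realize ρ] := by
    rw [realize_app]; congr 1; funext i; fin_cases i <;> rfl
  -- The bound a + b + 1 avoids any appeal to linearity of the order.
  refine ⟨suc (fn add ![a, b]), ?_, fun v => ?_⟩
  · rw [eq_top_iff]
    refine M.induction_on (.lt (Tm.var 0) (Tm.succ (Tm.app add ![Tm.var 0, Tm.var 1]))) ![b]
      (F := fun a => M.lt a (suc (fn add ![a, b]))) (fun a => ?_) ?_ (fun a => ?_) a
    · simp [realize_add, Term.realize]
    · simp
    · rw [suc_lt_suc, add_suc]; exact inf_le_right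
  · refine le_trans ?_ (M.le_lt_suc _ _)
    refine M.induction_on (.lt (Tm.var 1) (Tm.app add ![Tm.var 0, Tm.var 2])) ![v, b]
      (F := fun a => M.lt v (fn add ![a, b])) (fun a => ?_) ?_ (fun a => ?_) a
    · simp [realize_add, Term.realize]
    · rw [add_zer]
    · rw [add_suc]; exact inf_le_right.trans (M.le_lt_suc _ _)

end HAModel

/-! ### Bounded quantifiers -/

namespace Fml

/-- Replacement of the variable `0` by the variable `0` and of `i + 1` by `i + 2`. -/
def gap {n : ℕ} (φ : Fml (n + 1)) : Fml (n + 2) :=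
  φ.subst (Fin.cases (Tm.var 0) fun i => Tm.var i.succ.succ)

/-- For `φ(y)` with further parameters, the formula `∀ y < x, φ(y)` with `x` in place of `y`. -/
def ball {n : ℕ} (φ : Fml (n + 1)) : Fml (n + 1) := .allLt (Tm.var 0) φ.gap

/-- For `φ(y)` with further parameters, the formula `∃ y < x, φ(y)` with `x` in place of `y`. -/
def bex {n : ℕ} (φ : Fml (n + 1)) : Fml (n + 1) := .exLt (Tm.var 0) φ.gap

end Fml

namespace HAModel

variable {D L : Type} [HeytingAlgebra L] [arithLang.Structure D] (M : HAModel D L)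

@[simp] theorem eval_gap {n : ℕ} (φ : Fml (n + 1)) (x y : D) (ρ : Fin n → D) :
    M.eval φ.gap (vecCons y (vecCons x ρ)) = M.eval φ (vecCons y ρ) := by
  rw [Fml.gap, eval_subst]; congr 1; funext i; refine Fin.cases rfl (fun _ => rfl) i

theorem le_eval_ball {n : ℕ} {φ : Fml (n + 1)} {x : D} {ρ : Fin n → D} {a : L} :
    a ≤ M.eval φ.ball (vecCons x ρ) ↔ ∀ y, a ⊓ M.lt y x ≤ M.eval φ (vecCons y ρ) := by
  simp [Fml.ball, le_eval_allLt, Term.realize]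

theorem eval_bex_le {n : ℕ} {φ : Fml (n + 1)} {x : D} {ρ : Fin n → D} {a : L} :
    M.eval φ.bex (vecCons x ρ) ≤ a ↔ ∀ y, M.lt y x ⊓ M.eval φ (vecCons y ρ) ≤ a := by
  simp [Fml.bex, eval_exLt_le, Term.realize]

theorem eval_ball_inf_le {n : ℕ} (φ : Fml (n + 1)) (x y : D) (ρ : Fin n → D) :
    M.eval φ.ball (vecCons x ρ) ⊓ M.lt y x ≤ M.eval φ (vecCons y ρ) :=
  M.le_eval_ball.1 le_rfl y

theorem inf_le_eval_bex {n : ℕ} (φ : Fml (n + 1)) (x y : D) (ρ : Fin n → D) :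
    M.lt y x ⊓ M.eval φ (vecCons y ρ) ≤ M.eval φ.bex (vecCons x ρ) :=
  M.eval_bex_le.1 le_rfl y

theorem inf_eval_bex_le {n : ℕ} {φ : Fml (n + 1)} {x : D} {ρ : Fin n → D} {a b : L} :
    a ⊓ M.eval φ.bex (vecCons x ρ) ≤ b ↔
      ∀ y, a ⊓ M.lt y x ⊓ M.eval φ (vecCons y ρ) ≤ b := by
  simp only [inf_assoc, ← le_himp_iff', M.eval_bex_le]

@[simp] theorem eval_ball_zer {n : ℕ} (φ : Fml (n + 1)) (ρ : Fin n → D) :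
    M.eval φ.ball (vecCons (zer D) ρ) = ⊤ := by
  rw [eq_top_iff, le_eval_ball]; simp

@[simp] theorem eval_bex_zer {n : ℕ} (φ : Fml (n + 1)) (ρ : Fin n → D) :
    M.eval φ.bex (vecCons (zer D) ρ) = ⊥ := by
  rw [eq_bot_iff, eval_bex_le]; simp

@[simp] theorem eval_ball_suc {n : ℕ} (φ : Fml (n + 1)) (x : D) (ρ : Fin n → D) :
    M.eval φ.ball (vecCons (suc x) ρ) =
      M.eval φ.ball (vecCons x ρ) ⊓ M.eval φ (vecCons x ρ) := by
  refine le_antisymm (le_inf ?_ ?_) ?_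
  · exact M.le_eval_ball.2 fun y => (inf_le_inf_left _ (M.le_lt_suc y x)).trans
      (M.eval_ball_inf_le φ _ y ρ)
  · have := M.eval_ball_inf_le φ (suc x) x ρ
    rwa [M.lt_self_suc, inf_top_eq] at this
  · rw [le_eval_ball]
    intro y
    rw [lt_suc, inf_sup_left]
    refine sup_le ?_ ?_
    · exact (inf_le_inf_right _ inf_le_left).trans (M.eval_ball_inf_le φ x y ρ)
    · refine le_trans ?_ (M.E_inf_eval_le' φ y x ρ)
      exact le_inf inf_le_right (inf_le_left.trans inf_le_right)

@[simp] theorem eval_bex_suc {n : ℕ} (φ : Fml (n + 1)) (x : D) (ρ : Fin n → D) :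
    M.eval φ.bex (vecCons (suc x) ρ) =
      M.eval φ.bex (vecCons x ρ) ⊔ M.eval φ (vecCons x ρ) := by
  refine le_antisymm ?_ (sup_le ?_ ?_)
  · rw [eval_bex_le]
    intro y
    rw [lt_suc, inf_sup_right]
    exact sup_le_sup (M.inf_le_eval_bex φ x y ρ) (M.E_inf_eval_le φ y x ρ)
  · exact M.eval_bex_le.2 fun y => (inf_le_inf_right _ (M.le_lt_suc y x)).trans
      (M.inf_le_eval_bex φ _ y ρ)
  · have := M.inf_le_eval_bex φ (suc x) x ρ
    rwa [M.lt_self_suc, top_inf_eq] at this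

/-! ### Quantifier-free formulas -/

include M

theorem exists_fn_eq_realize {n : ℕ} (t : Tm n) : ∃ f : PR n, ∀ ρ : Fin n → D,
    fn f ρ = t.realize ρ := by
  induction t with
  | var i => exact ⟨.proj i, M.fn_proj i⟩
  | func f ts ih =>
    choose g hg using ih
    refine ⟨.comp f g, fun ρ => ?_⟩
    exact (M.fn_comp f g ρ).trans (congrArg (fn f) (funext fun i => hg i ρ))

theorem fn_const_zero {n : ℕ} (ρ : Fin n → D) : fn (.comp .zero ![]) ρ = zer D := by
  rw [M.fn_comp, zer]; congr 1; exact Subsingleton.elim _ _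

theorem eval_eq_app {n : ℕ} (f : PR 2) (t s : Tm n) (ρ : Fin n → D) :
    M.eval (.eq (Tm.app f ![t, s]) Tm.zero) ρ =
      M.E (fn f ![t.realize ρ, s.realize ρ]) (zer D) := by
  rw [eval_eq, realize_app, realize_zero]; congr 2; funext i; fin_cases i <;> rfl

/-- Truth is coded by 0 and falsity by any successor. Each connective is then computed by cases on
its first argument: here f(0, y) = y and f(x + 1, y) = 1. -/
theorem exists_PR_inf : ∃ f : PR 2, ∀ x y : D,
    M.E (fn f ![x, y]) (zer D) = M.E x (zer D) ⊓ M.E y (zer D) := by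
  let f : PR 2 := .prec (.proj 0) (.comp .succ ![.comp .zero ![]])
  refine ⟨f, fun x y => ?_⟩
  refine M.eq_of_cases (.eq (Tm.app f ![Tm.var 0, Tm.var 1]) Tm.zero)
    (.and (.eq (Tm.var 0) Tm.zero) (.eq (Tm.var 1) Tm.zero)) ![y]
    (F := fun x => M.E (fn f ![x, y]) (zer D)) (G := fun x => M.E x (zer D) ⊓ M.E y (zer D))
    (fun x => ?_) (fun x => ?_) ?_ (fun x => ?_) x
  · rw [eval_eq_app]; rfl
  · simp [Term.realize]
  · rw [M.fn_prec_zero, M.fn_proj]; simp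
  · rw [M.fn_prec_suc, M.fn_comp, E_suc_zer, bot_inf_eq]
    exact M.E_suc_zer _ ▸ congrArg (M.E · _) (congrArg (fn PR.succ) (by funext i; fin_cases i; rfl))

theorem exists_PR_sup : ∃ f : PR 2, ∀ x y : D,
    M.E (fn f ![x, y]) (zer D) = M.E x (zer D) ⊔ M.E y (zer D) := by
  let f : PR 2 := .prec (.comp .zero ![]) (.proj 2)
  refine ⟨f, fun x y => ?_⟩
  refine M.eq_of_cases (.eq (Tm.app f ![Tm.var 0, Tm.var 1]) Tm.zero)
    (.or (.eq (Tm.var 0) Tm.zero) (.eq (Tm.var 1) Tm.zero)) ![y]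
    (F := fun x => M.E (fn f ![x, y]) (zer D)) (G := fun x => M.E x (zer D) ⊔ M.E y (zer D))
    (fun x => ?_) (fun x => ?_) ?_ (fun x => ?_) x
  · rw [eval_eq_app]; rfl
  · simp [Term.realize]
  · rw [M.fn_prec_zero, M.fn_const_zero]; simp
  · rw [M.fn_prec_suc, M.fn_proj, E_suc_zer, bot_sup_eq]; rfl

theorem exists_PR_himp : ∃ f : PR 2, ∀ x y : D,
    M.E (fn f ![x, y]) (zer D) = M.E x (zer D) ⇨ M.E y (zer D) := by
  let f : PR 2 := .prec (.proj 0) (.comp .zero ![])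
  refine ⟨f, fun x y => ?_⟩
  refine M.eq_of_cases (.eq (Tm.app f ![Tm.var 0, Tm.var 1]) Tm.zero)
    (.imp (.eq (Tm.var 0) Tm.zero) (.eq (Tm.var 1) Tm.zero)) ![y]
    (F := fun x => M.E (fn f ![x, y]) (zer D)) (G := fun x => M.E x (zer D) ⇨ M.E y (zer D))
    (fun x => ?_) (fun x => ?_) ?_ (fun x => ?_) x
  · rw [eval_eq_app]; rfl
  · simp [Term.realize]
  · rw [M.fn_prec_zero, M.fn_proj]; simp
  · rw [M.fn_prec_suc, M.fn_const_zero, E_suc_zer]; simp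

theorem fn_comp_two {n : ℕ} (f : PR 2) (g h : PR n) (ρ : Fin n → D) :
    fn (.comp f ![g, h]) ρ = fn f ![fn g ρ, fn h ρ] := by
  rw [M.fn_comp]; congr 1; funext i; fin_cases i <;> rfl

/-- Quantifier-free formulas have characteristic functions. -/
theorem exists_char {n : ℕ} {φ : Fml n} (h : φ.IsQF) :
    ∃ f : PR n, ∀ ρ, M.eval φ ρ = M.E (fn f ρ) (zer D) := by
  obtain ⟨fI, hI⟩ := M.exists_PR_inf
  obtain ⟨fS, hS⟩ := M.exists_PR_sup
  obtain ⟨fH, hH⟩ := M.exists_PR_himp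
  induction φ with
  | falsum =>
    refine ⟨.comp .succ fun _ => .comp .zero ![], fun ρ => ?_⟩
    rw [M.fn_comp, eval_falsum]
    exact (M.E_suc_zer (zer D)).symm.trans (congrArg (M.E · _) (congrArg (fn PR.succ)
      (by funext i; fin_cases i; exact (M.fn_const_zero ρ).symm)))
  | eq t s =>
    obtain ⟨f, hf⟩ := M.exists_fn_eq_realize t
    obtain ⟨g, hg⟩ := M.exists_fn_eq_realize s
    refine ⟨.comp fI ![.comp PR.monus ![f, g], .comp PR.monus ![g, f]], fun ρ => ?_⟩
    rw [M.fn_comp_two, hI, M.fn_comp_two, M.fn_comp_two, hf, hg, eval_eq, ← M.monus_antisymm,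
      inf_comm]
    rfl
  | and φ ψ ih₁ ih₂ =>
    obtain ⟨f, hf⟩ := ih₁ h.1
    obtain ⟨g, hg⟩ := ih₂ h.2
    exact ⟨.comp fI ![f, g], fun ρ => by rw [M.fn_comp_two, hI, eval_and, hf, hg]⟩
  | or φ ψ ih₁ ih₂ =>
    obtain ⟨f, hf⟩ := ih₁ h.1
    obtain ⟨g, hg⟩ := ih₂ h.2
    exact ⟨.comp fS ![f, g], fun ρ => by rw [M.fn_comp_two, hS, eval_or, hf, hg]⟩
  | imp φ ψ ih₁ ih₂ =>
    obtain ⟨f, hf⟩ := ih₁ h.1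
    obtain ⟨g, hg⟩ := ih₂ h.2
    exact ⟨.comp fH ![f, g], fun ρ => by rw [M.fn_comp_two, hH, eval_imp, hf, hg]⟩
  | all => exact h.elim
  | ex => exact h.elim

theorem E_zer_sup_compl (x : D) : M.E x (zer D) ⊔ (M.E x (zer D))ᶜ = ⊤ := by
  rw [eq_top_iff]
  refine M.cases_on (.or (.eq (Tm.var 0) Tm.zero) (.neg (.eq (Tm.var 0) Tm.zero))) ![]
    (F := fun x => M.E x (zer D) ⊔ (M.E x (zer D))ᶜ) (fun x => ?_) ?_ (fun x => ?_) x
  · simp [Term.realize]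
  · simp
  · simp

theorem eval_sup_compl_of_isQF {n : ℕ} {φ : Fml n} (h : φ.IsQF) (ρ : Fin n → D) :
    M.eval φ ρ ⊔ (M.eval φ ρ)ᶜ = ⊤ := by
  obtain ⟨f, hf⟩ := M.exists_char h
  rw [hf, E_zer_sup_compl]

/-- Quantifier-free formulas are closed under bounded quantification up to equivalence. -/
theorem exists_isQF_eval_eq_ball {n : ℕ} {φ : Fml (n + 1)} (h : φ.IsQF) :
    ∃ ψ : Fml (n + 1), ψ.IsQF ∧ ∀ ρ, M.eval ψ ρ = M.eval φ.ball ρ := by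
  obtain ⟨f, hf⟩ := M.exists_char h
  obtain ⟨g, hg⟩ := M.exists_PR_inf
  -- F(0) = 0 is the empty conjunction and F(y + 1) is the conjunction, by `g`, of F(y) with f(y).
  -- Projection 1 is the previous value; the arguments of `f` skip it.
  let F : PR (n + 1) := .prec (.comp .zero ![])
    (.comp g ![.proj 1, .comp f (vecCons (.proj 0) fun i => .proj i.succ.succ)])
  refine ⟨.eq (Tm.app F Tm.var) Tm.zero, trivial, fun ρ => ?_⟩
  obtain ⟨x, ρ, rfl⟩ : ∃ x σ, ρ = vecCons x σ := ⟨_, _, (cons_head_tail ρ).symm⟩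
  have hF (ρ : Fin (n + 1) → D) :
      M.eval (.eq (Tm.app F Tm.var) Tm.zero) ρ = M.E (fn F ρ) (zer D) := by
    rw [eval_eq, realize_app, realize_zero]; rfl
  refine M.eq_of_induction (.eq (Tm.app F Tm.var) Tm.zero) φ.ball ρ (fun _ => rfl) (fun _ => rfl)
    ?_ (fun x => ?_) x
  · rw [hF, M.fn_prec_zero, M.fn_const_zero]; simp
  · have : M.eval (.eq (Tm.app F Tm.var) Tm.zero) (vecCons (suc x) ρ) =
        M.E (fn F (vecCons x ρ)) (zer D) ⊓ M.eval φ (vecCons x ρ) := by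
      rw [hF, M.fn_prec_suc, M.fn_comp_two, hg, M.fn_proj, M.fn_comp, hf]
      congr 3
      funext i
      refine Fin.cases ?_ (fun i => ?_) i
      · exact M.fn_proj _ _
      · exact M.fn_proj _ _
    rw [this, hF, eval_ball_suc, bihimp_def, bihimp_def]
    refine le_inf ?_ ?_ <;> rw [le_himp_iff]
    · refine le_inf ?_ (inf_le_right.trans inf_le_right)
      exact (le_inf (inf_le_left.trans inf_le_left) (inf_le_right.trans inf_le_left)).trans
        himp_inf_le
    · refine le_inf ?_ (inf_le_right.trans inf_le_right)
      exact (le_inf (inf_le_left.trans inf_le_right) (inf_le_right.trans inf_le_left)).trans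
        himp_inf_le

end HAModel

/-! ### The classes of prenex formulas -/

theorem mem_sigma_succ {k n : ℕ} {φ : Fml n} :
    φ ∈ SigmaClass (k + 1) n ↔ ExBlock (PiClass k) n φ := by
  simp [SigmaClass]

theorem mem_pi_succ {k n : ℕ} {φ : Fml n} :
    φ ∈ PiClass (k + 1) n ↔ AllBlock (SigmaClass k) n φ := by
  simp [PiClass]

theorem mem_sigma_zero {n : ℕ} {φ : Fml n} : φ ∈ SigmaClass 0 n ↔ φ.IsQF := by
  simp [SigmaClass]

theorem mem_pi_zero {n : ℕ} {φ : Fml n} : φ ∈ PiClass 0 n ↔ φ.IsQF := by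
  simp [PiClass]

namespace Fml

theorem IsQF.subst {n : ℕ} {φ : Fml n} (h : φ.IsQF) : ∀ {m : ℕ} (σ : Fin n → Tm m),
    (φ.subst σ).IsQF := by
  induction φ with
  | falsum => exact fun _ => trivial
  | eq => exact fun _ => trivial
  | and φ ψ h₁ h₂ => exact fun σ => ⟨h₁ h.1 σ, h₂ h.2 σ⟩
  | or φ ψ h₁ h₂ => exact fun σ => ⟨h₁ h.1 σ, h₂ h.2 σ⟩
  | imp φ ψ h₁ h₂ => exact fun σ => ⟨h₁ h.1 σ, h₂ h.2 σ⟩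
  | all => exact h.elim
  | ex => exact h.elim

theorem IsQF.dual_eq {n : ℕ} {φ : Fml n} (h : φ.IsQF) : φ.dual = φ.neg := by
  cases φ <;> first | rfl | exact h.elim

theorem IsQF.neg {n : ℕ} {φ : Fml n} (h : φ.IsQF) : φ.neg.IsQF := ⟨h, trivial⟩

theorem dual_subst {n m : ℕ} (φ : Fml n) (σ : Fin n → Tm m) :
    (φ.subst σ).dual = φ.dual.subst σ := by
  induction φ generalizing m with
  | all φ ih => exact congrArg Fml.ex (ih _)
  | ex φ ih => exact congrArg Fml.all (ih _)
  | falsum => rfl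
  | eq => rfl
  | and => rfl
  | or => rfl
  | imp => rfl

theorem dual_shift {n : ℕ} (φ : Fml n) : φ.shift.dual = φ.dual.shift := dual_subst φ _

end Fml

theorem ExBlock.subst {C : FmlClass}
    (hC : ∀ {n m : ℕ} {φ : Fml n} (σ : Fin n → Tm m), φ ∈ C n → φ.subst σ ∈ C m)
    {n : ℕ} {φ : Fml n} (h : ExBlock C n φ) :
    ∀ {m : ℕ} (σ : Fin n → Tm m), ExBlock C m (φ.subst σ) := by
  induction h with
  | one h => exact fun σ => .one (hC _ h)
  | more _ ih => exact fun σ => .more (ih _)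

theorem AllBlock.subst {C : FmlClass}
    (hC : ∀ {n m : ℕ} {φ : Fml n} (σ : Fin n → Tm m), φ ∈ C n → φ.subst σ ∈ C m)
    {n : ℕ} {φ : Fml n} (h : AllBlock C n φ) :
    ∀ {m : ℕ} (σ : Fin n → Tm m), AllBlock C m (φ.subst σ) := by
  induction h with
  | one h => exact fun σ => .one (hC _ h)
  | more _ ih => exact fun σ => .more (ih _)

theorem subst_mem_sigma_pi (k : ℕ) :
    (∀ {n m : ℕ} {φ : Fml n} (σ : Fin n → Tm m), φ ∈ SigmaClass k n → φ.subst σ ∈ SigmaClass k m) ∧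
    (∀ {n m : ℕ} {φ : Fml n} (σ : Fin n → Tm m), φ ∈ PiClass k n → φ.subst σ ∈ PiClass k m) := by
  induction k with
  | zero =>
    simp only [mem_sigma_zero, mem_pi_zero]
    exact ⟨fun σ h => h.subst σ, fun σ h => h.subst σ⟩
  | succ k ih =>
    simp only [mem_sigma_succ, mem_pi_succ]
    exact ⟨fun σ h => h.subst ih.2 σ, fun σ h => h.subst ih.1 σ⟩

theorem subst_mem_sigma {k n m : ℕ} {φ : Fml n} (h : φ ∈ SigmaClass k n) (σ : Fin n → Tm m) :
    φ.subst σ ∈ SigmaClass k m := (subst_mem_sigma_pi k).1 σ h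

theorem subst_mem_pi {k n m : ℕ} {φ : Fml n} (h : φ ∈ PiClass k n) (σ : Fin n → Tm m) :
    φ.subst σ ∈ PiClass k m := (subst_mem_sigma_pi k).2 σ h

theorem ExBlock.dual {C C' : FmlClass} (hC : ∀ {n : ℕ} {φ : Fml n}, φ ∈ C n → φ.dual ∈ C' n)
    {n : ℕ} {φ : Fml n} (h : ExBlock C n φ) : AllBlock C' n φ.dual := by
  induction h with
  | one h => exact .one (hC h)
  | more _ ih => exact .more ih

theorem AllBlock.dual {C C' : FmlClass} (hC : ∀ {n : ℕ} {φ : Fml n}, φ ∈ C n → φ.dual ∈ C' n)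
    {n : ℕ} {φ : Fml n} (h : AllBlock C n φ) : ExBlock C' n φ.dual := by
  induction h with
  | one h => exact .one (hC h)
  | more _ ih => exact .more ih

theorem dual_mem_sigma_pi (k : ℕ) :
    (∀ {n : ℕ} {φ : Fml n}, φ ∈ SigmaClass k n → φ.dual ∈ PiClass k n) ∧
    (∀ {n : ℕ} {φ : Fml n}, φ ∈ PiClass k n → φ.dual ∈ SigmaClass k n) := by
  induction k with
  | zero =>
    simp only [mem_sigma_zero, mem_pi_zero]
    exact ⟨fun h => h.dual_eq ▸ h.neg, fun h => h.dual_eq ▸ h.neg⟩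
  | succ k ih =>
    simp only [mem_sigma_succ, mem_pi_succ]
    exact ⟨fun h => h.dual ih.2, fun h => h.dual ih.1⟩

theorem dual_mem_pi {k n : ℕ} {φ : Fml n} (h : φ ∈ SigmaClass k n) : φ.dual ∈ PiClass k n :=
  (dual_mem_sigma_pi k).1 h

theorem dual_mem_sigma {k n : ℕ} {φ : Fml n} (h : φ ∈ PiClass k n) : φ.dual ∈ SigmaClass k n :=
  (dual_mem_sigma_pi k).2 h

/-- The formulas in `Σ_j` or `Π_j`. -/
def Level (j : ℕ) {n : ℕ} (φ : Fml n) : Prop := φ ∈ SigmaClass j n ∨ φ ∈ PiClass j n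

/-- Induction on the prefix of a prenex formula. -/
theorem Level.induction {m : ℕ} {P : ∀ {n : ℕ}, Fml n → Prop}
    (qf : ∀ {n : ℕ} {φ : Fml n}, φ.IsQF → P φ)
    (ex : ∀ {j n : ℕ} {φ : Fml (n + 1)}, j < m → φ.ex ∈ SigmaClass (j + 1) n → P φ → P φ.ex)
    (all : ∀ {j n : ℕ} {φ : Fml (n + 1)}, j < m → φ.all ∈ PiClass (j + 1) n → P φ → P φ.all) :
    ∀ {j : ℕ}, j ≤ m → ∀ {n : ℕ} {φ : Fml n}, Level j φ → P φ := by
  intro j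
  induction j with
  | zero =>
    rintro - n φ (h | h)
    · exact qf (mem_sigma_zero.1 h)
    · exact qf (mem_pi_zero.1 h)
  | succ j ih =>
    rintro hj n φ (h | h)
    · replace h := mem_sigma_succ.1 h
      induction h with
      | one h => exact ex hj (mem_sigma_succ.2 (.one h)) (ih (by omega) (.inr h))
      | more h ih' => exact ex hj (mem_sigma_succ.2 (.more h)) ih'
    · replace h := mem_pi_succ.1 h
      induction h with
      | one h => exact all hj (mem_pi_succ.2 (.one h)) (ih (by omega) (.inl h))
      | more h ih' => exact all hj (mem_pi_succ.2 (.more h)) ih'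

namespace HAModel

variable {D L : Type} [HeytingAlgebra L] [arithLang.Structure D] (M : HAModel D L)

/-! ### Duals -/

theorem eval_inf_eval_dual {j n : ℕ} {φ : Fml n} (h : Level j φ) :
    ∀ ρ : Fin n → D, M.eval φ ρ ⊓ M.eval φ.dual ρ = ⊥ := by
  refine Level.induction (P := fun {n} φ => ∀ ρ : Fin n → D, M.eval φ ρ ⊓ M.eval φ.dual ρ = ⊥)
    (fun h ρ => ?_) (fun {_ _ φ} _ _ ih ρ => ?_) (fun {_ _ φ} _ _ ih ρ => ?_) le_rfl h
  · rw [h.dual_eq, eval_neg, inf_compl_self]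
  · rw [eq_bot_iff, inf_comm, inf_eval_ex_le]
    intro x
    rw [← ih, inf_comm]
    exact inf_le_inf_left _ (M.eval_all_le φ.dual ρ x)
  · rw [eq_bot_iff]
    refine M.inf_eval_ex_le.2 fun x => ?_
    rw [← ih]
    exact inf_le_inf_right _ (M.eval_all_le φ ρ x)

theorem eval_dual_le_compl {j n : ℕ} {φ : Fml n} (h : Level j φ) (ρ : Fin n → D) :
    M.eval φ.dual ρ ≤ (M.eval φ ρ)ᶜ := by
  rw [le_compl_iff_disjoint_left, disjoint_iff, M.eval_inf_eval_dual h]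

theorem eval_dual_dual {j n : ℕ} {φ : Fml n} (h : Level j φ) :
    ∀ ρ : Fin n → D, M.eval φ.dual.dual ρ = M.eval φ ρ := by
  refine Level.induction (P := fun {n} φ => ∀ ρ : Fin n → D, M.eval φ.dual.dual ρ = M.eval φ ρ)
    (fun h ρ => ?_) (fun {_ _ φ} _ _ ih ρ => ?_) (fun {_ _ φ} _ _ ih ρ => ?_) le_rfl h
  · rw [h.dual_eq, h.neg.dual_eq, eval_neg, eval_neg]
    exact (IsCompl.of_eq (inf_compl_self _) (M.eval_sup_compl_of_isQF h ρ)).symm.compl_eq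
  · exact M.eval_ex_congr fun x => ih _
  · exact M.eval_all_congr fun x => ih _

/-! ### Closure properties up to equivalence -/

/-- The formulas that are equivalent in the model to a formula in `C`. -/
def cl (C : FmlClass) : FmlClass := fun n => {φ | ∃ ψ ∈ C n, ∀ ρ, M.eval ψ ρ = M.eval φ ρ}

theorem subset_cl {C : FmlClass} {n : ℕ} {φ : Fml n} (h : φ ∈ C n) : φ ∈ M.cl C n :=
  ⟨φ, h, fun _ => rfl⟩

variable {M}

theorem cl_congr {C : FmlClass} {n : ℕ} {φ ψ : Fml n} (h : φ ∈ M.cl C n)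
    (e : ∀ ρ, M.eval φ ρ = M.eval ψ ρ) : ψ ∈ M.cl C n :=
  let ⟨χ, hχ, hχ'⟩ := h
  ⟨χ, hχ, fun ρ => (hχ' ρ).trans (e ρ)⟩

theorem cl_bind {C C' : FmlClass} (h : ∀ {n : ℕ} {φ : Fml n}, φ ∈ C n → φ ∈ M.cl C' n)
    {n : ℕ} {φ : Fml n} (hφ : φ ∈ M.cl C n) : φ ∈ M.cl C' n :=
  let ⟨_, hψ, e⟩ := hφ
  cl_congr (h hψ) e

theorem subst_mem_cl {C : FmlClass}
    (hC : ∀ {n m : ℕ} {φ : Fml n} (σ : Fin n → Tm m), φ ∈ C n → φ.subst σ ∈ C m)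
    {n m : ℕ} {φ : Fml n} (h : φ ∈ M.cl C n) (σ : Fin n → Tm m) : φ.subst σ ∈ M.cl C m :=
  let ⟨ψ, hψ, e⟩ := h
  ⟨ψ.subst σ, hC σ hψ, fun ρ => by rw [eval_subst, eval_subst, e]⟩

theorem ex_mem_cl_of_pi {k n : ℕ} {φ : Fml (n + 1)} (h : φ ∈ M.cl (PiClass k) (n + 1)) :
    φ.ex ∈ M.cl (SigmaClass (k + 1)) n :=
  let ⟨ψ, hψ, e⟩ := h
  ⟨ψ.ex, mem_sigma_succ.2 (.one hψ), fun _ => M.eval_ex_congr fun _ => e _⟩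

theorem ex_mem_cl {k n : ℕ} {φ : Fml (n + 1)} (h : φ ∈ M.cl (SigmaClass (k + 1)) (n + 1)) :
    φ.ex ∈ M.cl (SigmaClass (k + 1)) n :=
  let ⟨ψ, hψ, e⟩ := h
  ⟨ψ.ex, mem_sigma_succ.2 (.more (mem_sigma_succ.1 hψ)), fun _ => M.eval_ex_congr fun _ => e _⟩

theorem all_mem_cl_of_sigma {k n : ℕ} {φ : Fml (n + 1)} (h : φ ∈ M.cl (SigmaClass k) (n + 1)) :
    φ.all ∈ M.cl (PiClass (k + 1)) n :=
  let ⟨ψ, hψ, e⟩ := h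
  ⟨ψ.all, mem_pi_succ.2 (.one hψ), fun _ => M.eval_all_congr fun _ => e _⟩

theorem all_mem_cl {k n : ℕ} {φ : Fml (n + 1)} (h : φ ∈ M.cl (PiClass (k + 1)) (n + 1)) :
    φ.all ∈ M.cl (PiClass (k + 1)) n :=
  let ⟨ψ, hψ, e⟩ := h
  ⟨ψ.all, mem_pi_succ.2 (.more (mem_pi_succ.1 hψ)), fun _ => M.eval_all_congr fun _ => e _⟩

/-- Add a dummy quantifier. Quantifier blocks are nonempty, so the hierarchy is cumulative only up
to equivalence. -/
theorem pi_subset_cl_sigma_succ {k n : ℕ} {φ : Fml n} (h : φ ∈ PiClass k n) :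
    φ ∈ M.cl (SigmaClass (k + 1)) n := by
  refine cl_congr (ex_mem_cl_of_pi (M.subset_cl (subst_mem_pi h fun i => Tm.var i.succ)))
    fun ρ => le_antisymm (M.eval_ex_le.2 fun x => (M.eval_shift φ x ρ).le) ?_
  exact (M.eval_shift φ (zer D) ρ).ge.trans (M.le_eval_ex _ _ _)

theorem sigma_subset_cl_pi_succ {k n : ℕ} {φ : Fml n} (h : φ ∈ SigmaClass k n) :
    φ ∈ M.cl (PiClass (k + 1)) n := by
  refine cl_congr (all_mem_cl_of_sigma (M.subset_cl (subst_mem_sigma h fun i => Tm.var i.succ)))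
    fun ρ => le_antisymm ?_ (M.le_eval_all.2 fun x => (M.eval_shift φ x ρ).ge)
  exact (M.eval_all_le _ _ _).trans (M.eval_shift φ (zer D) ρ).le

theorem subset_cl_succ (k : ℕ) :
    (∀ {n : ℕ} {φ : Fml n}, φ ∈ SigmaClass k n → φ ∈ M.cl (SigmaClass (k + 1)) n) ∧
    (∀ {n : ℕ} {φ : Fml n}, φ ∈ PiClass k n → φ ∈ M.cl (PiClass (k + 1)) n) := by
  induction k with
  | zero =>
    refine ⟨fun h => pi_subset_cl_sigma_succ ?_, fun h => sigma_subset_cl_pi_succ ?_⟩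
    · rwa [mem_pi_zero, ← mem_sigma_zero]
    · rwa [mem_sigma_zero, ← mem_pi_zero]
  | succ k ih =>
    refine ⟨fun h => ?_, fun h => ?_⟩
    · replace h := mem_sigma_succ.1 h
      induction h with
      | one h => exact ex_mem_cl_of_pi (ih.2 h)
      | more _ ih' => exact ex_mem_cl ih'
    · replace h := mem_pi_succ.1 h
      induction h with
      | one h => exact all_mem_cl_of_sigma (ih.1 h)
      | more _ ih' => exact all_mem_cl ih'

theorem sigma_subset_cl {i j : ℕ} (hij : i ≤ j) {n : ℕ} {φ : Fml n} (h : φ ∈ SigmaClass i n) :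
    φ ∈ M.cl (SigmaClass j) n := by
  induction hij with
  | refl => exact M.subset_cl h
  | step _ ih => exact cl_bind (subset_cl_succ _).1 ih

theorem pi_subset_cl {i j : ℕ} (hij : i ≤ j) {n : ℕ} {φ : Fml n} (h : φ ∈ PiClass i n) :
    φ ∈ M.cl (PiClass j) n := by
  induction hij with
  | refl => exact M.subset_cl h
  | step _ ih => exact cl_bind (subset_cl_succ _).2 ih

theorem sigma_subset_cl_pi {i j : ℕ} (hij : i < j) {n : ℕ} {φ : Fml n}
    (h : φ ∈ SigmaClass i n) : φ ∈ M.cl (PiClass j) n :=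
  cl_bind (pi_subset_cl hij) (sigma_subset_cl_pi_succ h)

/-- The body of a universal formula in `Π_{k+1}` is equivalent to a formula in `Π_{k+1}`. -/
theorem mem_cl_of_all_mem_pi {k n : ℕ} {φ : Fml (n + 1)} (h : φ.all ∈ PiClass (k + 1) n) :
    φ ∈ M.cl (PiClass (k + 1)) (n + 1) := by
  rcases mem_pi_succ.1 h with h | h
  · exact sigma_subset_cl_pi_succ h
  · exact M.subset_cl (mem_pi_succ.2 h)

/-- Implications with decidable premise can be moved into the prefix. -/
theorem imp_mem_cl (k : ℕ) :
    (∀ {n : ℕ} {δ φ : Fml n}, δ.IsQF → φ ∈ SigmaClass k n → δ.imp φ ∈ M.cl (SigmaClass k) n) ∧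
    (∀ {n : ℕ} {δ φ : Fml n}, δ.IsQF → φ ∈ PiClass k n → δ.imp φ ∈ M.cl (PiClass k) n) := by
  have hex {n : ℕ} {δ : Fml n} {φ : Fml (n + 1)} (hδ : δ.IsQF) (ρ : Fin n → D) :
      M.eval (δ.shift.imp φ).ex ρ = M.eval (δ.imp φ.ex) ρ := by
    refine le_antisymm (M.eval_ex_le.2 fun x => ?_) ?_
    · rw [eval_imp, eval_imp, eval_shift]
      exact himp_le_himp_left (M.le_eval_ex _ _ _)
    -- Decide δ: if it holds, the conclusion supplies the witness; if it fails, any witness will do,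
    -- here 0.
    · refine le_of_le_sup (le_top.trans (M.eval_sup_compl_of_isQF hδ ρ).ge) ?_ ?_
      · rw [eval_imp, himp_inf_self]
        refine inf_le_left.trans (M.eval_ex_le.2 fun x => le_trans ?_ (M.le_eval_ex _ _ x))
        rw [eval_imp]
        exact le_himp
      · refine inf_le_right.trans (le_trans ?_ (M.le_eval_ex _ _ (zer D)))
        rw [eval_imp, eval_shift]
        exact compl_le_himp
  have hall {n : ℕ} {δ : Fml n} {φ : Fml (n + 1)} (ρ : Fin n → D) :
      M.eval (δ.shift.imp φ).all ρ = M.eval (δ.imp φ.all) ρ := by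
    refine eq_of_forall_le_iff fun a => ?_
    simp [M.le_eval_all]
  induction k with
  | zero =>
    simp only [mem_sigma_zero, mem_pi_zero]
    exact ⟨fun hδ h => M.subset_cl (mem_sigma_zero.2 ⟨hδ, h⟩),
      fun hδ h => M.subset_cl (mem_pi_zero.2 ⟨hδ, h⟩)⟩
  | succ k ih =>
    refine ⟨fun hδ h => ?_, fun hδ h => ?_⟩
    · replace h := mem_sigma_succ.1 h
      induction h with
      | one h => exact cl_congr (ex_mem_cl_of_pi (ih.2 (hδ.subst _) h)) (hex hδ)
      | more _ ih' => exact cl_congr (ex_mem_cl (ih' (hδ.subst _))) (hex hδ)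
    · replace h := mem_pi_succ.1 h
      induction h with
      | one h => exact cl_congr (all_mem_cl_of_sigma (ih.1 (hδ.subst _) h)) hall
      | more _ ih' => exact cl_congr (all_mem_cl (ih' (hδ.subst _))) hall

/-- The leading block of one conjunct is pulled out completely before that of the other; the two
blocks then merge into one, and the matrices are conjoined one level lower. -/
theorem and_mem_cl (k : ℕ) :
    (∀ {n : ℕ} {φ ψ : Fml n}, φ ∈ SigmaClass k n → ψ ∈ SigmaClass k n →
      φ.and ψ ∈ M.cl (SigmaClass k) n) ∧
    (∀ {n : ℕ} {φ ψ : Fml n}, φ ∈ PiClass k n → ψ ∈ PiClass k n →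
      φ.and ψ ∈ M.cl (PiClass k) n) := by
  have hex {n : ℕ} (φ : Fml (n + 1)) (ψ : Fml n) (ρ : Fin n → D) :
      M.eval (φ.and ψ.shift).ex ρ = M.eval (φ.ex.and ψ) ρ := by
    refine eq_of_forall_ge_iff fun a => ?_
    rw [M.eval_ex_le, eval_and, inf_comm, M.inf_eval_ex_le]
    simp [inf_comm]
  have hex' {n : ℕ} (φ : Fml (n + 1)) (ψ : Fml n) (ρ : Fin n → D) :
      M.eval (ψ.shift.and φ).ex ρ = M.eval (ψ.and φ.ex) ρ := by
    refine eq_of_forall_ge_iff fun a => ?_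
    rw [M.eval_ex_le, eval_and, M.inf_eval_ex_le]
    simp
  have hall {n : ℕ} (φ : Fml (n + 1)) (ψ : Fml n) (ρ : Fin n → D) :
      M.eval (φ.and ψ.shift).all ρ = M.eval (φ.all.and ψ) ρ := by
    refine eq_of_forall_le_iff fun a => ?_
    simp only [M.le_eval_all, eval_and, eval_shift, le_inf_iff]
    exact ⟨fun h => ⟨fun x => (h x).1, (h (zer D)).2⟩, fun h x => ⟨h.1 x, h.2⟩⟩
  have hall' {n : ℕ} (φ : Fml (n + 1)) (ψ : Fml n) (ρ : Fin n → D) :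
      M.eval (ψ.shift.and φ).all ρ = M.eval (ψ.and φ.all) ρ := by
    refine eq_of_forall_le_iff fun a => ?_
    simp only [M.le_eval_all, eval_and, eval_shift, le_inf_iff]
    exact ⟨fun h => ⟨(h (zer D)).1, fun x => (h x).2⟩, fun h x => ⟨h.1, h.2 x⟩⟩
  induction k with
  | zero =>
    simp only [mem_sigma_zero, mem_pi_zero]
    exact ⟨fun h h' => M.subset_cl (mem_sigma_zero.2 ⟨h, h'⟩),
      fun h h' => M.subset_cl (mem_pi_zero.2 ⟨h, h'⟩)⟩
  | succ k ih =>
    have hsig {n : ℕ} {φ ψ : Fml n} (h : φ ∈ PiClass k n) (h' : ψ ∈ SigmaClass (k + 1) n) :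
        φ.and ψ ∈ M.cl (SigmaClass (k + 1)) n := by
      replace h' := mem_sigma_succ.1 h'
      induction h' with
      | one h' => exact cl_congr (ex_mem_cl_of_pi (ih.2 (subst_mem_pi h _) h')) (hex' _ _)
      | more _ ih' => exact cl_congr (ex_mem_cl (ih' (subst_mem_pi h _))) (hex' _ _)
    have hpi {n : ℕ} {φ ψ : Fml n} (h : φ ∈ SigmaClass k n) (h' : ψ ∈ PiClass (k + 1) n) :
        φ.and ψ ∈ M.cl (PiClass (k + 1)) n := by
      replace h' := mem_pi_succ.1 h'
      induction h' with
      | one h' => exact cl_congr (all_mem_cl_of_sigma (ih.1 (subst_mem_sigma h _) h')) (hall' _ _)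
      | more _ ih' => exact cl_congr (all_mem_cl (ih' (subst_mem_sigma h _))) (hall' _ _)
    refine ⟨fun h h' => ?_, fun h h' => ?_⟩
    · replace h := mem_sigma_succ.1 h
      induction h with
      | one h => exact cl_congr (ex_mem_cl (hsig h (subst_mem_sigma h' _))) (hex _ _)
      | more _ ih' => exact cl_congr (ex_mem_cl (ih' (subst_mem_sigma h' _))) (hex _ _)
    · replace h := mem_pi_succ.1 h
      induction h with
      | one h => exact cl_congr (all_mem_cl (hpi h (subst_mem_pi h' _))) (hall _ _)
      | more _ ih' => exact cl_congr (all_mem_cl (ih' (subst_mem_pi h' _))) (hall _ _)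

end HAModel

/-! ### Collection and bounded quantifiers -/

/-- Exchange of the variables `0` and `1`. -/
def Fml.swap {n : ℕ} (φ : Fml (n + 2)) : Fml (n + 2) :=
  φ.subst (Fin.cases (Tm.var 1) (Fin.cases (Tm.var 0) fun i => Tm.var i.succ.succ))

/-- Identification of the variables `0` and `1`. -/
def Fml.diag {n : ℕ} (φ : Fml (n + 2)) : Fml (n + 1) :=
  φ.subst (Fin.cases (Tm.var 0) Tm.var)

namespace HAModel

variable {D L : Type} [HeytingAlgebra L] [arithLang.Structure D] (M : HAModel D L)

@[simp] theorem eval_swap {n : ℕ} (φ : Fml (n + 2)) (x y : D) (ρ : Fin n → D) :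
    M.eval φ.swap (vecCons x (vecCons y ρ)) = M.eval φ (vecCons y (vecCons x ρ)) := by
  rw [Fml.swap, eval_subst]; congr 1; funext i
  refine Fin.cases rfl (fun i => Fin.cases rfl (fun _ => rfl) i) i

@[simp] theorem eval_diag {n : ℕ} (φ : Fml (n + 2)) (x : D) (ρ : Fin n → D) :
    M.eval φ.diag (vecCons x ρ) = M.eval φ (vecCons x (vecCons x ρ)) := by
  rw [Fml.diag, eval_subst]; congr 1; funext i
  refine Fin.cases rfl (fun i => rfl) i

theorem eval_bex_mono {n : ℕ} (φ : Fml (n + 1)) (ρ : Fin n → D) {x y : D}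
    (h : ∀ v, M.lt v x ≤ M.lt v y) :
    M.eval φ.bex (vecCons x ρ) ≤ M.eval φ.bex (vecCons y ρ) :=
  M.eval_bex_le.2 fun v => (inf_le_inf_right _ (h v)).trans (M.inf_le_eval_bex φ y v ρ)

theorem eval_le_eval_bex {n : ℕ} (φ : Fml (n + 1)) (ρ : Fin n → D) {x y : D}
    (h : M.lt x y = ⊤) : M.eval φ (vecCons x ρ) ≤ M.eval φ.bex (vecCons y ρ) := by
  simpa [h] using M.inf_le_eval_bex φ y x ρ

/-- The collection principle: `∀ y < x ∃ z φ(z, y)` is equivalent to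
`∃ w ∀ y < x ∃ z < w φ(z, y)`. -/
theorem eval_ball_ex {n : ℕ} (φ : Fml (n + 2)) (ρ : Fin (n + 1) → D) :
    M.eval φ.ex.ball ρ = M.eval φ.bex.swap.ball.swap.ex ρ := by
  obtain ⟨x, ρ, rfl⟩ : ∃ x σ, ρ = vecCons x σ := ⟨_, _, (cons_head_tail ρ).symm⟩
  refine le_antisymm ?_ ?_
  · rw [← himp_eq_top_iff, eq_top_iff]
    refine M.induction_on (φ.ex.ball.imp φ.bex.swap.ball.swap.ex) ρ
      (F := fun x => M.eval φ.ex.ball (vecCons x ρ) ⇨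
        M.eval φ.bex.swap.ball.swap.ex (vecCons x ρ)) (fun _ => eval_imp ..) ?_ (fun x => ?_) x
    · rw [le_himp_iff]
      refine le_trans ?_ (M.le_eval_ex _ _ (zer D))
      simp
    · rw [top_inf_eq, le_himp_iff, eval_ball_suc, ← inf_assoc, himp_inf_self]
      refine (inf_le_inf_right _ inf_le_left).trans (M.inf_eval_ex_le.2 fun z => ?_)
      rw [inf_comm]
      refine M.inf_eval_ex_le.2 fun w => ?_
      -- `w` bounds the witnesses for all y < x and `z` is a witness for y = x, so `c` has to
      -- dominate both.
      obtain ⟨c, hc, hc'⟩ := M.exists_lt_lt z w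
      refine le_trans ?_ (M.le_eval_ex _ _ c)
      simp only [eval_swap, eval_ball_suc]
      refine le_inf (inf_le_right.trans ?_) (inf_le_left.trans (M.eval_le_eval_bex _ _ hc))
      refine M.le_eval_ball.2 fun y => (M.eval_ball_inf_le _ _ y _).trans ?_
      simp only [eval_swap]
      exact M.eval_bex_mono _ _ hc'
  · refine M.eval_ex_le.2 fun w => M.le_eval_ball.2 fun y => ?_
    rw [eval_swap]
    refine (M.eval_ball_inf_le _ _ y _).trans ?_
    rw [eval_swap]
    exact M.eval_bex_le.2 fun z => inf_le_right.trans (M.le_eval_ex _ _ z)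

/-- Two existential quantifiers have a common bound. -/
theorem eval_ex_ex {n : ℕ} (φ : Fml (n + 2)) (ρ : Fin n → D) :
    M.eval φ.ex.ex ρ = M.eval φ.bex.swap.bex.diag.ex ρ := by
  refine le_antisymm ?_ ?_
  · refine M.eval_ex_le.2 fun z => M.eval_ex_le.2 fun w => ?_
    -- The second bound from `exists_lt_lt` is not strict, hence `suc w`.
    obtain ⟨c, hc, hc'⟩ := M.exists_lt_lt z (suc w)
    refine le_trans ?_ (M.le_eval_ex _ _ c)
    rw [eval_diag]
    refine le_trans ?_ (M.eval_le_eval_bex _ _ hc)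
    rw [eval_swap]
    exact M.eval_le_eval_bex _ _ (top_le_iff.1 ((M.lt_self_suc w).ge.trans (hc' w)))
  · refine M.eval_ex_le.2 fun c => ?_
    rw [eval_diag]
    refine M.eval_bex_le.2 fun z => inf_le_right.trans ?_
    rw [eval_swap]
    refine M.eval_bex_le.2 fun w => inf_le_right.trans ?_
    exact (M.le_eval_ex _ _ w).trans (M.le_eval_ex _ _ z)

/-- Every formula of level at most `m` is decided in the sense that it or its dual holds. -/
def Dec (m : ℕ) : Prop :=
  ∀ ⦃j : ℕ⦄, j ≤ m → ∀ ⦃n : ℕ⦄ ⦃φ : Fml n⦄, Level j φ → ∀ ρ, M.eval φ ρ ⊔ M.eval φ.dual ρ = ⊤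

variable {M}

theorem Dec.isCompl {m : ℕ} (hdec : M.Dec m) {j : ℕ} (hj : j ≤ m) {n : ℕ} {φ : Fml n}
    (h : Level j φ) (ρ : Fin n → D) : IsCompl (M.eval φ ρ) (M.eval φ.dual ρ) :=
  IsCompl.of_eq (M.eval_inf_eval_dual h ρ) (hdec hj h ρ)

/-- Decidability passes to bounded search: by induction on the bound, each new instance either
supplies a witness or extends the bounded conjunction of duals. -/
theorem Dec.isCompl_bex_ball {m : ℕ} (hdec : M.Dec m) {j : ℕ} (hj : j ≤ m) {n : ℕ}
    {φ : Fml (n + 1)} (h : Level j φ) (ρ : Fin (n + 1) → D) :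
    IsCompl (M.eval φ.bex ρ) (M.eval φ.dual.ball ρ) := by
  obtain ⟨x, ρ, rfl⟩ : ∃ x σ, ρ = vecCons x σ := ⟨_, _, (cons_head_tail ρ).symm⟩
  refine IsCompl.of_eq ?_ ?_
  · rw [eq_bot_iff, inf_comm]
    refine M.inf_eval_bex_le.2 fun y => (inf_le_inf_right _ (M.eval_ball_inf_le _ _ y _)).trans ?_
    rw [inf_comm, M.eval_inf_eval_dual h]
  · rw [eq_top_iff]
    refine M.induction_on (φ.bex.or φ.dual.ball) ρ
      (F := fun x => M.eval φ.bex (vecCons x ρ) ⊔ M.eval φ.dual.ball (vecCons x ρ))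
      (fun _ => eval_or ..) (by simp) (fun x => ?_) x
    rw [eval_bex_suc, eval_ball_suc, top_inf_eq]
    refine sup_le (le_sup_left.trans le_sup_left) ?_
    refine le_of_le_sup (le_top.trans (hdec hj h (vecCons x ρ)).ge) ?_ le_sup_right
    exact inf_le_right.trans (le_sup_right.trans le_sup_left)

theorem pi_ball_mem_cl {j n : ℕ} {φ : Fml (n + 1)} (h : φ ∈ PiClass j (n + 1)) :
    φ.ball ∈ M.cl (PiClass j) (n + 1) := by
  cases j with
  | zero =>
    obtain ⟨ψ, hψ, e⟩ := M.exists_isQF_eval_eq_ball (mem_pi_zero.1 h)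
    exact ⟨ψ, mem_pi_zero.2 hψ, e⟩
  -- The premise y < x is an equation and moves into the prefix; the quantifier over y joins the
  -- leading block.
  | succ j => exact all_mem_cl ((imp_mem_cl _).2 trivial (subst_mem_pi h _))

/-- Given decidability up to level `m`, if `Σ_j` is closed under bounded universal quantification,
then `Π_j` is closed under bounded existential quantification, for `j ≤ m`. -/
theorem Dec.bex_mem_cl {m : ℕ} (hdec : M.Dec m) {j : ℕ} (hj : j ≤ m)
    (hball : ∀ {n : ℕ} {φ : Fml (n + 1)}, φ ∈ SigmaClass j (n + 1) →
      φ.ball ∈ M.cl (SigmaClass j) (n + 1))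
    {n : ℕ} {φ : Fml (n + 1)} (h : φ ∈ PiClass j (n + 1)) : φ.bex ∈ M.cl (PiClass j) (n + 1) := by
  obtain ⟨A, hA, e⟩ := hball (dual_mem_sigma h)
  refine ⟨A.dual, dual_mem_pi hA, fun ρ => ?_⟩
  have h₁ := hdec.isCompl hj (.inl hA) ρ
  rw [e] at h₁
  -- Both `A.dual` and the bounded existential are complements of ∀y<x φ^⊥, and complements are
  -- unique.
  exact h₁.symm.left_unique (hdec.isCompl_bex_ball hj (.inr h) ρ)

theorem ball_mem_cl_of_mem_cl {C : FmlClass} (hC : ∀ {n : ℕ} {φ : Fml (n + 1)}, φ ∈ C (n + 1) →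
    φ.ball ∈ M.cl C (n + 1)) {n : ℕ} {φ : Fml (n + 1)} (h : φ ∈ M.cl C (n + 1)) :
    φ.ball ∈ M.cl C (n + 1) := by
  obtain ⟨ψ, hψ, e⟩ := h
  refine cl_congr (hC hψ) fun ρ => ?_
  obtain ⟨x, ρ, rfl⟩ : ∃ x σ, ρ = vecCons x σ := ⟨_, _, (cons_head_tail ρ).symm⟩
  exact eq_of_forall_le_iff fun a => by simp only [le_eval_ball, e]

theorem bex_mem_cl_of_mem_cl {C : FmlClass} (hC : ∀ {n : ℕ} {φ : Fml (n + 1)}, φ ∈ C (n + 1) →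
    φ.bex ∈ M.cl C (n + 1)) {n : ℕ} {φ : Fml (n + 1)} (h : φ ∈ M.cl C (n + 1)) :
    φ.bex ∈ M.cl C (n + 1) := by
  obtain ⟨ψ, hψ, e⟩ := h
  refine cl_congr (hC hψ) fun ρ => ?_
  obtain ⟨x, ρ, rfl⟩ : ∃ x σ, ρ = vecCons x σ := ⟨_, _, (cons_head_tail ρ).symm⟩
  exact eq_of_forall_ge_iff fun a => by simp only [eval_bex_le, e]

/-- Given decidability up to level `m`, the class `Σ_j` is closed under bounded universal
quantification for `j ≤ m + 1`. -/
theorem Dec.sigma_ball_mem_cl {m : ℕ} (hdec : M.Dec m) {j : ℕ} (hj : j ≤ m + 1) :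
    ∀ {n : ℕ} {φ : Fml (n + 1)}, φ ∈ SigmaClass j (n + 1) →
      φ.ball ∈ M.cl (SigmaClass j) (n + 1) := by
  induction j with
  | zero =>
    intro n φ h
    obtain ⟨ψ, hψ, e⟩ := M.exists_isQF_eval_eq_ball (mem_sigma_zero.1 h)
    exact ⟨ψ, mem_sigma_zero.2 hψ, e⟩
  | succ j ih =>
    -- Only j ≤ m is needed for Π_j, so decidability up to level m reaches Σ_{m+1}.
    have hbex {n : ℕ} {φ : Fml (n + 1)} : φ ∈ M.cl (PiClass j) (n + 1) →
        φ.bex ∈ M.cl (PiClass j) (n + 1) :=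
      bex_mem_cl_of_mem_cl (hdec.bex_mem_cl (by omega) (ih (by omega)))
    have hsubst {n l : ℕ} {φ : Fml n} (h : φ ∈ M.cl (PiClass j) n) (σ : Fin n → Tm l) :
        φ.subst σ ∈ M.cl (PiClass j) l := subst_mem_cl (fun σ h => subst_mem_pi h σ) h σ
    -- A block of existential quantifiers is contracted to a single one; the bounded quantifiers
    -- this creates are absorbed by Π_j.
    have hcontr {n : ℕ} {φ : Fml n} (h : φ ∈ SigmaClass (j + 1) n) :
        ∃ ψ ∈ M.cl (PiClass j) (n + 1), ∀ ρ, M.eval ψ.ex ρ = M.eval φ ρ := by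
      replace h := mem_sigma_succ.1 h
      induction h with
      | one h => exact ⟨_, M.subset_cl h, fun _ => rfl⟩
      | more _ ih' =>
        obtain ⟨ψ, hψ, e⟩ := ih'
        refine ⟨ψ.bex.swap.bex.diag, hsubst (hbex (hsubst (hbex hψ) _)) _, fun ρ => ?_⟩
        rw [← eval_ex_ex]
        exact M.eval_ex_congr fun _ => e _
    intro n φ h
    obtain ⟨ψ, hψ, e⟩ := hcontr h
    -- Collection brings the unbounded ∃ to the front, leaving a matrix ∀y<x ∃z<w ψ that is
    -- equivalent to a Π_j formula.
    refine cl_congr (ex_mem_cl_of_pi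
      (hsubst (ball_mem_cl_of_mem_cl pi_ball_mem_cl (hsubst (hbex hψ) _)) _)) fun ρ =>
      (M.eval_ball_ex ψ ρ).symm.trans ?_
    obtain ⟨x, ρ, rfl⟩ : ∃ x σ, ρ = vecCons x σ := ⟨_, _, (cons_head_tail ρ).symm⟩
    exact eq_of_forall_le_iff fun a => by simp only [le_eval_ball, e]

end HAModel

namespace HAModel

variable {D L : Type} [HeytingAlgebra L] [arithLang.Structure D] {M : HAModel D L}

/-! ### Validity of the principles -/

theorem valid_DNE_iff {C : FmlClass} : M.Valid (DNE C) ↔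
    ∀ ⦃n : ℕ⦄ ⦃φ : Fml n⦄, φ ∈ C n → ∀ ρ, (M.eval φ ρ)ᶜᶜ ≤ M.eval φ ρ := by
  refine ⟨fun h n φ hφ ρ => ?_, ?_⟩
  · simpa using h ⟨φ, hφ, rfl⟩ ρ
  · rintro h n _ ⟨φ, hφ, rfl⟩ ρ
    simpa using h hφ ρ

theorem valid_DML_iff {C : FmlClass} : M.Valid (DML C) ↔
    ∀ ⦃n : ℕ⦄ ⦃φ ψ : Fml n⦄, φ ∈ C n → ψ ∈ C n → ∀ ρ,
      (M.eval φ ρ ⊓ M.eval ψ ρ)ᶜ ≤ (M.eval φ ρ)ᶜ ⊔ (M.eval ψ ρ)ᶜ := by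
  refine ⟨fun h n φ ψ hφ hψ ρ => ?_, ?_⟩
  · simpa using h ⟨φ, hφ, ψ, hψ, rfl⟩ ρ
  · rintro h n _ ⟨φ, hφ, ψ, hψ, rfl⟩ ρ
    simpa using h hφ hψ ρ

theorem valid_DMLDual_iff {C : FmlClass} : M.Valid (DMLDual C) ↔
    ∀ ⦃n : ℕ⦄ ⦃φ ψ : Fml n⦄, φ ∈ C n → ψ ∈ C n → ∀ ρ,
      (M.eval φ ρ ⊓ M.eval ψ ρ)ᶜ ≤ M.eval φ.dual ρ ⊔ M.eval ψ.dual ρ := by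
  refine ⟨fun h n φ ψ hφ hψ ρ => ?_, ?_⟩
  · simpa using h ⟨φ, hφ, ψ, hψ, rfl⟩ ρ
  · rintro h n _ ⟨φ, hφ, ψ, hψ, rfl⟩ ρ
    simpa using h hφ hψ ρ

theorem valid_CD_iff {C C' : FmlClass} : M.Valid (CD C C') ↔
    ∀ ⦃n : ℕ⦄ ⦃φ : Fml n⦄ ⦃ψ : Fml (n + 1)⦄, φ ∈ C n → ψ ∈ C' (n + 1) → ∀ ρ,
      M.eval (φ.shift.or ψ).all ρ ≤ M.eval φ ρ ⊔ M.eval ψ.all ρ := by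
  refine ⟨fun h n φ ψ hφ hψ ρ => ?_, ?_⟩
  · simpa using h ⟨φ, hφ, ψ, hψ, rfl⟩ ρ
  · rintro h n _ ⟨φ, hφ, ψ, hψ, rfl⟩ ρ
    simpa using h hφ hψ ρ

theorem valid_add_iff {P Q : FmlClass} : M.Valid (P.add Q) ↔ M.Valid P ∧ M.Valid Q :=
  ⟨fun h => ⟨fun _ _ hφ => h (.inl hφ), fun _ _ hφ => h (.inr hφ)⟩,
    fun h _ _ hφ => hφ.elim (fun hφ => h.1 hφ) fun hφ => h.2 hφ⟩

theorem eval_subst_up_up {n : ℕ} (φ : Fml (n + 2)) (z y w : D) (ρ : Fin n → D) :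
    M.eval (φ.subst (Tm.up (Tm.up fun i => Tm.var i.succ)))
      (vecCons z (vecCons y (vecCons w ρ))) = M.eval φ (vecCons z (vecCons y ρ)) := by
  rw [eval_subst]
  congr 1; funext i
  refine Fin.cases rfl (fun i => ?_) i
  simp only [Tm.up, Fin.cases_succ, realize_shift, cons_val_succ]
  refine Fin.cases rfl (fun i => ?_) i
  rw [Fin.cases_succ, realize_shift]
  rfl

/-- The premise of the collection principle. -/
def collPremise {n : ℕ} (x : Fin n) (φ : Fml (n + 2)) : Fml n :=
  (Fml.exLt (Tm.var x.succ) (Fml.allLt (Tm.var 1)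
    (φ.subst (Tm.up (Tm.up fun i => Tm.var i.succ))))).all

theorem valid_COLL_iff {C : FmlClass} : M.Valid (COLL C) ↔
    ∀ ⦃n : ℕ⦄ (x : Fin n) ⦃φ : Fml (n + 2)⦄, φ ∈ C (n + 2) → ∀ ρ,
      M.eval (collPremise x φ) ρ ≤ M.eval (.exLt (Tm.var x) φ.all) ρ := by
  refine ⟨fun h n x φ hφ ρ => ?_, ?_⟩
  · simpa [collPremise] using h ⟨x, φ, hφ, rfl⟩ ρ
  · rintro h n _ ⟨x, φ, hφ, rfl⟩ ρ
    simpa [collPremise] using h x hφ ρ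

/-! ### The implications -/

/-- Since ¬∃ is intuitionistically ∀¬, existential quantifiers cost nothing; so information about
Π_m reaches Σ_{m+1}. -/
theorem compl_le_eval_dual_of_sigma {m : ℕ}
    (h : ∀ {n : ℕ} {φ : Fml n}, φ ∈ PiClass m n → ∀ ρ, (M.eval φ ρ)ᶜ ≤ M.eval φ.dual ρ)
    {n : ℕ} {φ : Fml n} (hφ : φ ∈ SigmaClass (m + 1) n) :
    ∀ ρ, (M.eval φ ρ)ᶜ ≤ M.eval φ.dual ρ := by
  replace hφ := mem_sigma_succ.1 hφ
  induction hφ with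
  | one hφ =>
    exact fun ρ => M.le_eval_all.2 fun x => (compl_le_compl (M.le_eval_ex _ _ x)).trans (h hφ _)
  | more _ ih =>
    exact fun ρ => M.le_eval_all.2 fun x => (compl_le_compl (M.le_eval_ex _ _ x)).trans (ih _)

/-- The two inequalities go together, since dualizing exchanges them. At each quantifier one of them
passes through ¬∃ = ∀¬, and the other follows from it by DNE for whichever of the formula and its
dual is existential. -/
theorem compl_le_eval_dual {m : ℕ} (h : M.Valid (DNE (SigmaClass m))) {j : ℕ} (hj : j ≤ m) {n : ℕ}
    {φ : Fml n} (hφ : Level j φ) :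
    ∀ ρ, (M.eval φ ρ)ᶜ ≤ M.eval φ.dual ρ ∧ (M.eval φ.dual ρ)ᶜ ≤ M.eval φ ρ := by
  have hdne {j n : ℕ} {φ : Fml n} (hj : j < m) (hφ : φ ∈ SigmaClass (j + 1) n) (ρ : Fin n → D) :
      (M.eval φ ρ)ᶜᶜ ≤ M.eval φ ρ := by
    obtain ⟨ψ, hψ, e⟩ := sigma_subset_cl (M := M) hj hφ
    rw [← e]
    exact valid_DNE_iff.1 h hψ ρ
  refine Level.induction (P := fun {n} φ => ∀ ρ : Fin n → D,
      (M.eval φ ρ)ᶜ ≤ M.eval φ.dual ρ ∧ (M.eval φ.dual ρ)ᶜ ≤ M.eval φ ρ)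
    (fun {_ φ} h ρ => ?_) (fun {_ _ φ} hj h ih ρ => ?_) (fun {_ _ φ} hj h ih ρ => ?_) hj hφ
  · rw [h.dual_eq, eval_neg, ← eval_neg, ← eval_neg, ← h.neg.dual_eq, ← h.dual_eq,
      M.eval_dual_dual (j := 0) (.inl (mem_sigma_zero.2 h))]
    exact ⟨le_rfl, le_rfl⟩
  · have h₁ : (M.eval φ.ex ρ)ᶜ ≤ M.eval φ.ex.dual ρ :=
      M.le_eval_all.2 fun x => (compl_le_compl (M.le_eval_ex _ _ x)).trans (ih _).1
    exact ⟨h₁, (compl_le_compl h₁).trans (hdne hj h ρ)⟩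
  · have h₁ : (M.eval φ.all.dual ρ)ᶜ ≤ M.eval φ.all ρ :=
      M.le_eval_all.2 fun x => (compl_le_compl (M.le_eval_ex φ.dual _ x)).trans (ih _).2
    exact ⟨(compl_le_compl h₁).trans (hdne hj (dual_mem_sigma h) ρ), h₁⟩

theorem Valid.dmlDual_of_dml {m : ℕ}
    (h : M.Valid ((DML (SigmaClass (m + 1))).add (DNE (SigmaClass m)))) :
    M.Valid (DMLDual (SigmaClass (m + 1))) := by
  obtain ⟨h₁, h₂⟩ := valid_add_iff.1 h
  have h₃ {n : ℕ} {φ : Fml n} := compl_le_eval_dual_of_sigma (M := M) (m := m) (φ := φ)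
    fun hφ ρ => (compl_le_eval_dual h₂ le_rfl (.inr hφ) ρ).1
  exact valid_DMLDual_iff.2 fun n φ ψ hφ hψ ρ =>
    (valid_DML_iff.1 h₁ hφ hψ ρ).trans (sup_le_sup (h₃ hφ ρ) (h₃ hψ ρ))

/-- Apply the principle to φ^⊥ and ψ^⊥: since a dual implies the negation, ¬¬(φ ∨ ψ) refutes φ^⊥ ∧
ψ^⊥, and double duals cancel. -/
theorem Valid.dne_or_of_dmlDual {k : ℕ} (h : M.Valid (DMLDual (SigmaClass k))) :
    M.Valid (DNE ((PiClass k).or (PiClass k))) := by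
  rw [valid_DNE_iff]
  rintro n _ ⟨φ, hφ, ψ, hψ, rfl⟩ ρ
  have := valid_DMLDual_iff.1 h (dual_mem_sigma hφ) (dual_mem_sigma hψ) ρ
  rw [M.eval_dual_dual (.inr hφ), M.eval_dual_dual (.inr hψ)] at this
  rw [eval_or]
  refine le_trans (compl_le_compl ?_) this
  rw [compl_sup]
  exact inf_le_inf (M.eval_dual_le_compl (.inr hφ) ρ) (M.eval_dual_le_compl (.inr hψ) ρ)

/-- The premise of CD proves ¬¬(φ ∨ ∀x ψ): under ¬φ it yields ψ(x) for every x. -/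
theorem Valid.cd_of_dne_or {m : ℕ} (h : M.Valid (DNE ((PiClass (m + 1)).or (PiClass (m + 1))))) :
    M.Valid (CD (PiClass (m + 1)) (PiClass (m + 1))) := by
  rw [valid_CD_iff]
  intro n φ ψ hφ hψ ρ
  have := valid_DNE_iff.1 h
    ⟨φ, hφ, ψ.all, mem_pi_succ.2 (.more (mem_pi_succ.1 hψ)), rfl⟩ ρ
  rw [eval_or] at this
  refine le_trans ?_ this
  rw [le_compl_iff_disjoint_right, disjoint_iff, compl_sup, eq_bot_iff,
    ← inf_compl_self (M.eval ψ.all ρ)]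
  refine le_inf (M.le_eval_all.2 fun x => ?_) (inf_le_right.trans inf_le_right)
  have hx := M.eval_all_le (φ.shift.or ψ) ρ x
  rw [eval_or, eval_shift] at hx
  refine (inf_le_inf hx inf_le_left).trans ?_
  rw [inf_sup_right, inf_compl_self, bot_sup_eq]
  exact inf_le_left

theorem Valid.cd_cl {k : ℕ} (h : M.Valid (CD (PiClass k) (PiClass k))) {n : ℕ} {φ : Fml n}
    {ψ : Fml (n + 1)} (hφ : φ ∈ M.cl (PiClass k) n) (hψ : ψ ∈ M.cl (PiClass k) (n + 1))
    {ρ : Fin n → D} {a : L} (ha : ∀ x, a ≤ M.eval φ ρ ⊔ M.eval ψ (vecCons x ρ)) :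
    a ≤ M.eval φ ρ ⊔ M.eval ψ.all ρ := by
  obtain ⟨φ', hφ', e⟩ := hφ
  obtain ⟨ψ', hψ', e'⟩ := hψ
  have := valid_CD_iff.1 h hφ' hψ' ρ
  rw [e, M.eval_all_congr (ψ := ψ) fun x => e' _] at this
  refine le_trans (M.le_eval_all.2 fun x => ?_) this
  rw [eval_or, eval_shift, e, e']
  exact ha x

/-- From φ(x) ∨ φ^⊥(x) one gets ∃x φ ∨ φ^⊥(x) for every x, and CD moves the quantifier inside. Dummy
quantifiers place the existential formula, of level at most `m`, in Π_{m+1}. -/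
theorem Valid.dec_of_cd {m : ℕ} (h : M.Valid (CD (PiClass (m + 1)) (PiClass (m + 1)))) :
    M.Dec m := by
  intro j hj n φ hφ
  refine Level.induction
    (P := fun {n} φ => ∀ ρ : Fin n → D, M.eval φ ρ ⊔ M.eval φ.dual ρ = ⊤)
    (fun {_ φ} hφ ρ => ?_) (fun {_ _ φ} hj hφ ih ρ => ?_) (fun {_ _ φ} hj hφ ih ρ => ?_) hj hφ
  · rw [hφ.dual_eq, eval_neg, M.eval_sup_compl_of_isQF hφ]
  · rw [eq_top_iff]
    refine h.cd_cl (sigma_subset_cl_pi (by omega) hφ)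
      (cl_bind (pi_subset_cl (by omega)) (mem_cl_of_all_mem_pi (dual_mem_pi hφ))) fun x => ?_
    rw [← ih (vecCons x ρ)]
    exact sup_le_sup_right (M.le_eval_ex _ _ x) _
  · rw [eq_top_iff, sup_comm]
    refine h.cd_cl (sigma_subset_cl_pi (by omega) (dual_mem_sigma hφ))
      (cl_bind (pi_subset_cl (by omega)) (mem_cl_of_all_mem_pi hφ)) fun x => ?_
    rw [← ih (vecCons x ρ), sup_comm]
    exact sup_le_sup_right (M.le_eval_ex φ.dual _ x) _

theorem Dec.compl_le_eval_dual {m : ℕ} (h : M.Dec m) {n : ℕ} {φ : Fml n} (hφ : Level m φ)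
    (ρ : Fin n → D) : (M.eval φ ρ)ᶜ ≤ M.eval φ.dual ρ := by
  rw [(h.isCompl le_rfl hφ ρ).compl_eq]

/-- Induction on the leading block of ψ: ¬(φ ∧ ∃x ψ) gives φ^⊥ ∨ ψ(x)^⊥ for every x, and CD applies
because φ^⊥ is in Π_{m+1}. -/
theorem Valid.dmlDual_of_cd {m : ℕ} (h : M.Valid (CD (PiClass (m + 1)) (PiClass (m + 1)))) :
    M.Valid (DMLDual (SigmaClass (m + 1))) := by
  have hdec := h.dec_of_cd
  rw [valid_DMLDual_iff]
  intro n φ ψ hφ hψ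
  replace hψ := mem_sigma_succ.1 hψ
  have step {n : ℕ} {φ : Fml n} {ψ : Fml (n + 1)} (hφ : φ ∈ SigmaClass (m + 1) n)
      (hψ : ψ.ex ∈ SigmaClass (m + 1) n)
      (ih : ∀ ρ, (M.eval φ.shift ρ ⊓ M.eval ψ ρ)ᶜ ≤ M.eval φ.shift.dual ρ ⊔ M.eval ψ.dual ρ)
      (ρ : Fin n → D) :
      (M.eval φ ρ ⊓ M.eval ψ.ex ρ)ᶜ ≤ M.eval φ.dual ρ ⊔ M.eval ψ.ex.dual ρ := by
    refine h.cd_cl (M.subset_cl (dual_mem_pi hφ)) (mem_cl_of_all_mem_pi (dual_mem_pi hψ))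
      fun x => ?_
    have := ih (vecCons x ρ)
    rw [Fml.dual_shift, eval_shift, eval_shift] at this
    exact le_trans (compl_le_compl (inf_le_inf_left _ (M.le_eval_ex _ _ x))) this
  induction hψ with
  | @one n ψ hψ =>
    refine step hφ (mem_sigma_succ.2 (.one hψ)) fun ρ => ?_
    -- The matrix ψ in Π_m is decidable. If ψ holds, then φ is refuted, whence φ^⊥; otherwise ψ^⊥
    -- holds.
    refine le_of_le_sup (le_top.trans (hdec le_rfl (.inr hψ) ρ).ge) (le_sup_of_le_left ?_)
      (inf_le_right.trans le_sup_right)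
    refine le_trans ?_ (compl_le_eval_dual_of_sigma
      (fun hφ ρ => hdec.compl_le_eval_dual (.inr hφ) ρ) (subst_mem_sigma hφ _) ρ)
    rw [le_compl_iff_disjoint_right, disjoint_iff, inf_assoc, inf_comm (M.eval ψ ρ),
      ← disjoint_iff]
    exact disjoint_compl_left
  | more hψ ih =>
    exact step hφ (mem_sigma_succ.2 (.more hψ)) (ih (subst_mem_sigma hφ _))

theorem Valid.dml_of_dmlDual {m : ℕ} (h : M.Valid (DMLDual (SigmaClass (m + 1)))) :
    M.Valid ((DML (SigmaClass (m + 1))).add (DNE (SigmaClass m))) := by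
  refine valid_add_iff.2 ⟨valid_DML_iff.2 fun n φ ψ hφ hψ ρ => ?_,
    valid_DNE_iff.2 fun n φ hφ ρ => ?_⟩
  · exact (valid_DMLDual_iff.1 h hφ hψ ρ).trans (sup_le_sup
      (M.eval_dual_le_compl (.inl hφ) ρ) (M.eval_dual_le_compl (.inl hψ) ρ))
  · have := h.dne_or_of_dmlDual.cd_of_dne_or.dec_of_cd.isCompl le_rfl (.inl hφ) ρ
    rw [this.compl_eq, this.symm.compl_eq]

/-- The disjunction φ ∨ ∀z ψ(z) is coded as ∃y<2 ∀z χ(y, z), where y = 0 selects φ and any other y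
selects ψ. -/
theorem Valid.cd_of_coll {k : ℕ} (h : M.Valid (COLL (PiClass k))) :
    M.Valid (CD (PiClass k) (PiClass k)) := by
  rw [valid_CD_iff]
  intro n φ ψ hφ hψ ρ
  -- Variables 0, 1, 2 of χ are z, y and the bound, so the parameters move up by three.
  let σ (i : Fin n) : Tm (n + 3) := Tm.var i.succ.succ.succ
  let δ : Fml (n + 3) := .eq (Tm.var 1) Tm.zero
  let χ : Fml (n + 3) :=
    (δ.imp (φ.subst σ)).and (δ.neg.imp (ψ.subst (Fin.cases (Tm.var 0) σ)))
  have hχ : χ ∈ M.cl (PiClass k) (n + 3) := by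
    obtain ⟨α, hα, e⟩ := (imp_mem_cl (M := M) k).2 (δ := δ) trivial (subst_mem_pi hφ σ)
    obtain ⟨β, hβ, e'⟩ := (imp_mem_cl (M := M) k).2 (δ := δ.neg) ⟨trivial, trivial⟩
      (subst_mem_pi hψ (Fin.cases (Tm.var 0) σ))
    exact cl_congr ((and_mem_cl k).2 hα hβ) fun ρ => by simp only [χ, eval_and, e, e']
  obtain ⟨χ', hχ', e⟩ := hχ
  set two : D := suc (suc (zer D)) with htwo
  have hev (z y : D) : M.eval χ' (vecCons z (vecCons y (vecCons two ρ))) =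
      (M.E y (zer D) ⇨ M.eval φ ρ) ⊓ ((M.E y (zer D))ᶜ ⇨ M.eval ψ (vecCons z ρ)) := by
    rw [e, eval_and, eval_imp, eval_imp, eval_neg, eval_subst, eval_subst, eval_eq, realize_zero]
    congr 3
    funext i
    refine Fin.cases rfl (fun _ => rfl) i
  refine le_trans ?_ ((valid_COLL_iff.1 h 0 hχ' (vecCons two ρ)).trans ?_)
  · refine M.le_eval_all.2 fun w => ?_
    -- CD with a bounded quantifier needs no principle: it is proved by induction on the bound.
    have hw : M.eval (φ.shift.or ψ).all ρ ≤ M.eval φ ρ ⊔ M.eval ψ.ball (vecCons w ρ) := by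
      refine M.induction_on (φ.shift.or ψ.ball) ρ
        (F := fun w => M.eval φ ρ ⊔ M.eval ψ.ball (vecCons w ρ)) (fun w => ?_) ?_ (fun w => ?_) w
      · rw [eval_or, eval_shift]
      · simp
      · rw [eval_ball_suc, sup_inf_left]
        refine le_inf inf_le_right (inf_le_left.trans ((M.eval_all_le _ _ w).trans ?_))
        rw [eval_or, eval_shift]
    have hex (y : D) (hy : M.lt y two = ⊤) (a : L)
        (ha : ∀ z, a ⊓ M.lt z w ≤ M.eval χ' (vecCons z (vecCons y (vecCons two ρ)))) :
        a ≤ M.eval (.exLt (Tm.var (0 : Fin (n + 1)).succ) (.allLt (Tm.var 1)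
          (χ'.subst (Tm.up (Tm.up fun i => Tm.var i.succ)))))
          (vecCons w (vecCons two ρ)) := by
      refine le_trans (le_inf ?_ (M.le_eval_allLt.2 fun z => ?_)) (M.inf_le_eval_exLt _ _ _ y)
      · exact le_top.trans hy.ge
      · rw [eval_subst_up_up]
        exact ha z
    refine hw.trans (sup_le (hex (zer D) (by simp [htwo]) _ fun z => ?_)
      (hex (suc (zer D)) (by simp [htwo]) _ fun z => ?_))
    · rw [hev]; simp
    · rw [hev]
      simpa using M.eval_ball_inf_le ψ w z ρ
  · refine M.eval_exLt_le.2 fun y => inf_le_right.trans ?_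
    refine le_of_le_sup (le_top.trans (M.E_zer_sup_compl y).ge) (le_sup_of_le_left ?_)
      (le_sup_of_le_right (M.le_eval_all.2 fun z => ?_))
    · refine (inf_le_inf_right _ ((M.eval_all_le _ _ (zer D)).trans (hev _ _).le)).trans ?_
      exact (inf_le_inf_right _ inf_le_left).trans himp_inf_le
    · refine (inf_le_inf_right _ ((M.eval_all_le _ _ z).trans (hev _ _).le)).trans ?_
      exact (inf_le_inf_right _ inf_le_right).trans himp_inf_le

/-- De Morgan's law for bounded conjunctions of `Σ_{m+1}`-formulas. -/
theorem Valid.compl_ball_le_bex_dual {m : ℕ} (h : M.Valid (DMLDual (SigmaClass (m + 1))))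
    {n : ℕ} {φ : Fml (n + 1)} (hφ : φ ∈ SigmaClass (m + 1) (n + 1)) (x : D) (ρ : Fin n → D) :
    (M.eval φ.ball (vecCons x ρ))ᶜ ≤ M.eval φ.dual.bex (vecCons x ρ) := by
  have hdec := h.dne_or_of_dmlDual.cd_of_dne_or.dec_of_cd
  -- To split off the last conjunct by the principle, the bounded conjunction before it must itself
  -- be in Σ_{m+1} up to equivalence.
  obtain ⟨α, hα, e⟩ := hdec.sigma_ball_mem_cl le_rfl hφ
  rw [← himp_eq_top_iff, eq_top_iff]
  refine M.induction_on (φ.ball.neg.imp φ.dual.bex) ρ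
    (F := fun x => (M.eval φ.ball (vecCons x ρ))ᶜ ⇨ M.eval φ.dual.bex (vecCons x ρ))
    (fun x => ?_) ?_ (fun x => ?_) x
  · rw [eval_imp, eval_neg]
  · simp
  · rw [top_inf_eq, le_himp_iff, eval_ball_suc, eval_bex_suc, ← e]
    refine (inf_le_inf_left _ (valid_DMLDual_iff.1 h hα hφ _)).trans ?_
    rw [inf_sup_left]
    refine sup_le_sup ?_ inf_le_right
    exact (inf_le_inf_left _ (M.eval_dual_le_compl (.inl hα) _)).trans himp_inf_le

/-- De Morgan's law for bounded conjunctions is applied to ∃z φ^⊥(y, z); the premise of COLL refutes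
the conjunction of these over y < x. -/
theorem Valid.coll_of_dmlDual {m : ℕ} (h : M.Valid (DMLDual (SigmaClass (m + 1)))) :
    M.Valid (COLL (PiClass (m + 1))) := by
  rw [valid_COLL_iff]
  intro n x φ hφ ρ
  have hall : φ.all ∈ PiClass (m + 1) (n + 1) := mem_pi_succ.2 (.more (mem_pi_succ.1 hφ))
  refine le_trans ?_ ((h.compl_ball_le_bex_dual (dual_mem_sigma hall) (ρ x) ρ).trans ?_)
  · rw [le_compl_iff_disjoint_right, disjoint_iff, eq_bot_iff]
    change _ ⊓ M.eval φ.dual.ex.ball _ ≤ _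
    -- Collection gives one `w` bounding all the witnesses z; the premise of COLL at this `w`
    -- provides a y < x without a witness below `w`.
    rw [eval_ball_ex]
    refine M.inf_eval_ex_le.2 fun w => ?_
    rw [eval_swap]
    refine (inf_le_inf_right _ (M.eval_all_le _ _ w)).trans ?_
    rw [inf_comm]
    refine M.inf_eval_exLt_le.2 fun y => ?_
    change _ ⊓ M.lt y (ρ x) ⊓ _ ≤ _
    refine (inf_le_inf_right _ (M.eval_ball_inf_le _ _ y _)).trans ?_
    rw [eval_swap, inf_comm]
    refine M.inf_eval_bex_le.2 fun z => ?_
    refine (inf_le_inf_right _ (M.eval_allLt_inf_le _ _ _ z)).trans ?_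
    rw [eval_subst_up_up, M.eval_inf_eval_dual (.inr hφ)]
  · refine M.eval_bex_le.2 fun y => ?_
    rw [M.eval_dual_dual (.inr hall)]
    exact M.inf_le_eval_exLt (Tm.var x) φ.all ρ y

end HAModel

end HeytingArith

-- The equivalence of the five principles.

theorem mainTheorem1 (k : ℕ) (hk : 1 ≤ k) :
    ∀ P ∈ [(HeytingArith.DML (HeytingArith.SigmaClass k)).add
            (HeytingArith.DNE (HeytingArith.SigmaClass (k - 1))),
          HeytingArith.DMLDual (HeytingArith.SigmaClass k),
          HeytingArith.CD (HeytingArith.PiClass k) (HeytingArith.PiClass k),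
          HeytingArith.COLL (HeytingArith.PiClass k),
          HeytingArith.DNE ((HeytingArith.PiClass k).or (HeytingArith.PiClass k))],
      ∀ Q ∈ [(HeytingArith.DML (HeytingArith.SigmaClass k)).add
              (HeytingArith.DNE (HeytingArith.SigmaClass (k - 1))),
            HeytingArith.DMLDual (HeytingArith.SigmaClass k),
            HeytingArith.CD (HeytingArith.PiClass k) (HeytingArith.PiClass k),
            HeytingArith.COLL (HeytingArith.PiClass k),
            HeytingArith.DNE ((HeytingArith.PiClass k).or (HeytingArith.PiClass k))],
        HeytingArith.EquivOver HeytingArith.HA P Q := by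
  obtain ⟨m, rfl⟩ : ∃ m, k = m + 1 := ⟨k - 1, by omega⟩
  -- DML^⊥ is the hub: each principle is valid in exactly the same models, which gives all pairs at
  -- once.
  have key : ∀ P ∈ [(HeytingArith.DML (HeytingArith.SigmaClass (m + 1))).add
            (HeytingArith.DNE (HeytingArith.SigmaClass (m + 1 - 1))),
          HeytingArith.DMLDual (HeytingArith.SigmaClass (m + 1)),
          HeytingArith.CD (HeytingArith.PiClass (m + 1)) (HeytingArith.PiClass (m + 1)),
          HeytingArith.COLL (HeytingArith.PiClass (m + 1)),
          HeytingArith.DNE ((HeytingArith.PiClass (m + 1)).or (HeytingArith.PiClass (m + 1)))],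
      ∀ {D L : Type} [HeytingAlgebra L] [HeytingArith.arithLang.Structure D]
        (M : HeytingArith.HAModel D L),
        M.Valid P ↔ M.Valid (HeytingArith.DMLDual (HeytingArith.SigmaClass (m + 1))) := by
    intro P hP D L _ _ M
    simp only [List.mem_cons, List.not_mem_nil, or_false, Nat.add_sub_cancel] at hP
    rcases hP with rfl | rfl | rfl | rfl | rfl
    · exact ⟨fun h => h.dmlDual_of_dml, fun h => h.dml_of_dmlDual⟩
    · exact Iff.rfl
    · exact ⟨fun h => h.dmlDual_of_cd, fun h => h.dne_or_of_dmlDual.cd_of_dne_or⟩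
    · exact ⟨fun h => h.cd_of_coll.dmlDual_of_cd, fun h => h.coll_of_dmlDual⟩
    · exact ⟨fun h => h.cd_of_dne_or.dmlDual_of_cd, fun h => h.dne_or_of_dmlDual⟩
  intro P hP Q hQ
  exact ⟨HeytingArith.provesAll_of_valid fun M h => (key Q hQ M).2 ((key P hP M).1 h),
    HeytingArith.provesAll_of_valid fun M h => (key P hP M).2 ((key Q hQ M).1 h)⟩
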